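/- Let $\Omega=\{0,1\}^{\mathbb N}$ be the Cantor space. Let $P_1$ be a computable probability measure on $\Omega_1=\Omega$, and let $(P^\omega)_{\omega\in\Omega_1}$ be a family of probability measures on $\Omega_2=\Omega$ that is computable uniformly in $\omega$: one machine with oracle $\omega$ approximates, for every $\omega\in\Omega_1$, every binary string $v$ and every $n$, the value $P^\omega([v])$ with error at most $2^{-n}$, where $[v]$ is the set of infinite extensions of $v$. Let $P$ be the probability measure on $\Omega_1\times\Omega_2$ with $\iint f\,dP=\int\!\int f(\omega,\omega')\,dP^\omega(\omega')\,dP_1(\omega)$. A $P_1$-test is a lower semicomputable function $t:\Omega_1\to[0,\infty]$ with $\int t\,dP_1\le 1$; a $P$-test is a lower semicomputable $t:\Omega_1\times\Omega_2\to[0,\infty]$ with $\iint t\,dP\le 1$; a conditional test is a lower semicomputable $t:\Omega_2\times\Omega_1\times\mathbb Z\to[0,\infty]$ with $\int t(\omega',\omega,k)\,dP^\omega(\omega')\le 1$ for all $\omega\in\Omega_1$ and $k\in\mathbb Z$. In each of the three classes, a test is maximal if every test of that class is bounded by a constant multiple of it. **Theorem (Vovk–Vyugin).** Maximal tests of all three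 kinds exist. Let $\mathbf t_{P_1}(\omega)$, $\mathbf t_P(\omega,\omega')$, $\mathbf t_{P^\omega}(\omega'\mid\omega,k)$ be any maximal tests, and let $\mathbf d_{P_1}$, $\mathbf d_P$, $\mathbf d_{P^\omega}$ be their binary logarithms, with values in $[-\infty,+\infty]$. Then $$\mathbf d_P(\omega,\omega')=\mathbf d_{P_1}(\omega)+\mathbf d_{P^\omega}\bigl(\omega'\mid\omega,\mathbf d_{P_1}(\omega)\bigr)+O(1)$$ for all $\omega\in\Omega_1$ and $\omega'\in\Omega_2$. Here $\mathbf d_{P_1}(\omega)$ in the condition is rounded to an integer $k$ in any way with bounded error: for every $r$ there is a $c$, not depending on $\omega$, $\omega'$ and $k$, such that the two sides differ by at most $c$ (infinite values being equal) for every $\omega$, $\omega'$ and every integer $k$ with $|k-\mathbf d_{P_1}(\omega)|\le r$ put in the condition; if $\mathbf d_{P_1}(\omega)=+\infty$, then $k$ may be any integer, and both sides are $+\infty$. -/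

import Mathlib

open MeasureTheory ProbabilityTheory
open scoped ENNReal NNReal

namespace VovkVyugin

/-- The Cantor space of infinite binary sequences (with its product topology and the product
`σ`-algebra, which is the Borel one). -/
abbrev Cantor : Type := ℕ → Bool

/-- The prefix of length `n` of an infinite sequence. -/
def initSeg (ω : Cantor) (n : ℕ) : List Bool := (List.range n).map ω

/-- The interval `[u]` of all infinite extensions of the string `u`. -/
def cyl (u : List Bool) : Set Cantor := {ω | initSeg ω u.length = u}

/-- The standard base of `Ω₁ × Ω₂`, consisting of the products `[u] × [v]`. -/
def cylPair (p : List Bool × List Bool) : Set (Cantor × Cantor) :=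
  cyl p.1 ×ˢ cyl p.2

/-- The standard base of `Ω₂ × Ω₁ × ℤ`, consisting of the sets `[v] × [u] × {k}`. -/
def cylCond (p : List Bool × List Bool × ℤ) : Set (Cantor × Cantor × ℤ) :=
  cyl p.1 ×ˢ cyl p.2.1 ×ˢ {p.2.2}

/-- A function `f : X → [0, ∞]` is lower semicomputable (with respect to an effectively indexed
base `B` of `X`) if the sets `{x | q < f x}` are effectively open, uniformly in the non-negative
rational `q = a / (b + 1)`: they are unions of base sets listed by one enumerable set `W`. -/
def LowerSemicomputable {X ι : Type} [Primcodable ι] (B : ι → Set X) (f : X → ℝ≥0∞) : Prop :=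
  ∃ W : ι × ℕ × ℕ → Prop, REPred W ∧
    ∀ (a b : ℕ) (x : X), (a : ℝ≥0∞) / ((b : ℝ≥0∞) + 1) < f x ↔ ∃ i, W (i, a, b) ∧ x ∈ B i

/-- A finite measure on the Cantor space is computable if the measures of the intervals `[u]` are
computable reals uniformly in `u`: an algorithm produces, given `u` and `n`, a rational
approximation with error at most `2⁻ⁿ`. -/
def IsComputableMeasure (μ : Measure Cantor) : Prop :=
  ∃ A : List Bool → ℕ → ℕ, Computable₂ A ∧
    ∀ u n, |μ.real (cyl u) - (A u n : ℝ) / 2 ^ n| ≤ 1 / 2 ^ n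

/-- The measures `κ ω` are computable uniformly in `ω`: one machine with oracle `ω` produces, given
`v` and `n`, an approximation to `κ ω [v]` with error at most `2⁻ⁿ`. Here `Φ (initSeg ω s) (v, n)`
is the state of the output after `s` steps, in which the machine could read only the first `s`
bits of the oracle (`none` if there is no answer yet). The machine has to answer for every `ω`. -/
def IsUniformlyComputable (κ : Kernel Cantor Cantor) : Prop :=
  ∃ Φ : List Bool → List Bool × ℕ → Option ℕ, Computable₂ Φ ∧
    ∀ (ω : Cantor) (v : List Bool) (n : ℕ),
      (∃ s a, Φ (initSeg ω s) (v, n) = some a) ∧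
      ∀ s a, Φ (initSeg ω s) (v, n) = some a →
        |(κ ω).real (cyl v) - (a : ℝ) / 2 ^ n| ≤ 1 / 2 ^ n

/-- Expectation-bounded randomness tests with respect to `μ`. -/
structure IsTest {X ι : Type} [Primcodable ι] [MeasurableSpace X] (B : ι → Set X)
    (μ : Measure X) (t : X → ℝ≥0∞) : Prop where
  lowerSemicomputable : LowerSemicomputable B t
  lintegral_le_one : ∫⁻ x, t x ∂μ ≤ 1

/-- A test that is maximal up to a constant factor. -/
structure IsMaximalTest {X ι : Type} [Primcodable ι] [MeasurableSpace X] (B : ι → Set X)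
    (μ : Measure X) (t : X → ℝ≥0∞) : Prop where
  isTest : IsTest B μ t
  maximal : ∀ s : X → ℝ≥0∞, IsTest B μ s → ∃ C : ℝ≥0, ∀ x, s x ≤ C * t x

/-- Conditional tests `t (ω', ω, k)`: tests in `ω'` with respect to `κ ω`, given the sequence `ω`
and the integer `k`. -/
structure IsCondTest (κ : Kernel Cantor Cantor) (t : Cantor × Cantor × ℤ → ℝ≥0∞) : Prop where
  lowerSemicomputable : LowerSemicomputable cylCond t
  lintegral_le_one : ∀ (ω : Cantor) (k : ℤ), ∫⁻ ω', t (ω', ω, k) ∂(κ ω) ≤ 1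

/-- A conditional test that is maximal up to a constant factor. -/
structure IsMaximalCondTest (κ : Kernel Cantor Cantor) (t : Cantor × Cantor × ℤ → ℝ≥0∞) :
    Prop where
  isCondTest : IsCondTest κ t
  maximal : ∀ s : Cantor × Cantor × ℤ → ℝ≥0∞, IsCondTest κ s → ∃ C : ℝ≥0, ∀ x, s x ≤ C * t x

/-- The binary logarithm `[0, ∞] → [-∞, ∞]`. -/
noncomputable def log2 (x : ℝ≥0∞) : EReal := ENNReal.log x / ((Real.log 2 : ℝ) : EReal)

/-- The randomness deficiency corresponding to a (maximal) test. -/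
noncomputable def deficiency {X : Type} (t : X → ℝ≥0∞) (x : X) : EReal := log2 (t x)

/-- The integer `k` is a rounding of `x` with error at most `r`. An infinite value has no nearby
integer, and any integer is admitted for it. -/
def IsRounding (r : ℝ) (x : EReal) (k : ℤ) : Prop :=
  x ≠ ⊤ → x ≤ (((k : ℝ) + r : ℝ) : EReal) ∧ (((k : ℝ) - r : ℝ) : EReal) ≤ x

end VovkVyugin

open VovkVyugin

namespace VovkVyugin

open Encodable Nat.Partrec

/-! Multiplicatively, the claim is that `t (ω, ω')` agrees with `t₁ ω * t₂ (ω', ω, k)` up to a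
constant factor whenever `2 ^ k` approximates `t₁ ω`.

The main tool is trimming. Up to an additive error of at most one, a lower semicomputable function
is the limit of an increasing sequence of step functions with natural values (`level`), obtained by
counting accepted integer thresholds. The integral of a step function under `κ ω` is a finite sum of
uniformly computable reals, so the condition that it is less than `L` is effectively open in `ω`.
Keeping only the stages that meet this condition (`trim`) gives a lower semicomputable function with
integral at most `L`, and nothing is lost if the whole integral was less than `L`. The additive
error is harmless, since the measures are probability measures. A weighted supremum of trimmed
functions over all codes is a maximal conditional test; a constant kernel yields the maximal test
for `P₁`.

Upper bound (`IsTest.exists_le_mul`): for a test `s` of the pair, the integral of `s (ω, ·)` under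
`κ ω` is, up to an additive constant, a multiple of a `P₁`-test, hence `O(t₁ ω)`. So when `2 ^ k` is
close to `t₁ ω`, trimming `s (ω, ·)` at a constant multiple of `2 ^ k` does not change it, and
division by this bound gives a conditional test. Trimming is what makes the bound hold for every
other `k` as well.

Lower bound (`isTest_prodTest`, `mul_le_prodTest`): the value of `t₁ ω` is only approximated from
below, so the supremum of `2 ^ k * t₂ (ω', ω, k)` is taken over all `k` with `2 ^ k` below a
multiple of `t₁ ω`. Its integral is bounded by a geometric sum of order `t₁ ω`. The two bounds
together show that this test is itself maximal for the pair. -/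

@[simp] theorem length_initSeg (ω : Cantor) (n : ℕ) : (initSeg ω n).length = n := by
  simp [initSeg]

theorem take_initSeg (ω : Cantor) {m n : ℕ} (h : m ≤ n) :
    (initSeg ω n).take m = initSeg ω m := by
  simp [initSeg, ← List.map_take, List.take_range, h]

theorem mem_cyl_initSeg (ω : Cantor) (n : ℕ) : ω ∈ cyl (initSeg ω n) := by
  simp [cyl]

theorem mem_cyl_iff {ω : Cantor} {u : List Bool} : ω ∈ cyl u ↔ initSeg ω u.length = u := Iff.rfl

/-- A recursively enumerable predicate is accepted by some code within some number of steps. -/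
theorem exists_code_of_rePred {α : Type*} [Primcodable α] {p : α → Prop} (hp : REPred p) :
    ∃ c : Code, ∀ a, p a ↔ ∃ s, (c.evaln s (encode a)).isSome := by
  obtain ⟨c, hc⟩ := Code.exists_code.1 hp
  refine ⟨c, fun a => ?_⟩
  have h1 : p a ↔ ∃ x, x ∈ c.eval (encode a) := by
    rw [hc]; simp
  rw [h1]
  constructor
  · rintro ⟨x, hx⟩
    obtain ⟨k, hk⟩ := Code.evaln_complete.1 hx
    exact ⟨k, by rw [Option.mem_def.1 hk]; rfl⟩
  · rintro ⟨s, hs⟩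
    obtain ⟨x, hx⟩ := Option.isSome_iff_exists.1 hs
    exact ⟨x, Code.evaln_sound hx⟩

theorem primrecPred_isSome {α β : Type*} [Primcodable α] [Primcodable β] {f : α → Option β}
    (hf : Primrec f) : PrimrecPred fun a => (f a).isSome = true := by
  have := Primrec.option_isSome.comp hf
  exact ⟨inferInstance, this.of_eq fun a => by simp⟩

/-! ### Effectively open relations between two sequences -/

/-- A property of two sequences, depending on a parameter, which is effectively open uniformly in
the parameter: it is witnessed by initial segments satisfying a primitive recursive relation. -/
def EffOpen {α : Type*} [Primcodable α] (A : α → Cantor → Cantor → Prop) : Prop :=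
  ∃ R : α × List Bool × List Bool → Prop, PrimrecPred R ∧
    ∀ p ω ω', A p ω ω' ↔ ∃ z, R (p, initSeg ω z, initSeg ω' z)

namespace EffOpen

variable {α β : Type*} [Primcodable α] [Primcodable β]

theorem of_iff {A B : α → Cantor → Cantor → Prop} (hA : EffOpen A)
    (h : ∀ p ω ω', B p ω ω' ↔ A p ω ω') : EffOpen B := by
  obtain ⟨R, hR, hRA⟩ := hA
  exact ⟨R, hR, fun p ω ω' => (h p ω ω').trans (hRA p ω ω')⟩

theorem comp {A : β → Cantor → Cantor → Prop} (hA : EffOpen A) {f : α → β} (hf : Primrec f) :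
    EffOpen fun p => A (f p) := by
  obtain ⟨R, hR, hRA⟩ := hA
  exact ⟨fun q => R (f q.1, q.2), hR.comp (Primrec.pair (hf.comp Primrec.fst) Primrec.snd),
    fun p => hRA (f p)⟩

theorem swap {A : α → Cantor → Cantor → Prop} (hA : EffOpen A) :
    EffOpen fun p ω ω' => A p ω' ω := by
  obtain ⟨R, hR, hRA⟩ := hA
  exact ⟨fun q => R (q.1, q.2.2, q.2.1), hR.comp (Primrec.pair Primrec.fst
    (Primrec.pair (Primrec.snd.comp Primrec.snd) (Primrec.fst.comp Primrec.snd))),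
    fun p ω ω' => hRA p ω' ω⟩

/-- The zero sequence is computable, so its prefixes can be generated instead of read. This allows a
computable condition to be fixed in a conditional test. -/
theorem zero_left {A : α → Cantor → Cantor → Prop} (hA : EffOpen A) :
    EffOpen fun p (_ : Cantor) ω' => A p (fun _ => false) ω' := by
  obtain ⟨R, hR, hRA⟩ := hA
  refine ⟨fun q => R (q.1, q.2.2.map (fun _ => false), q.2.2), hR.comp (Primrec.pair Primrec.fst
    (Primrec.pair ?_ (Primrec.snd.comp Primrec.snd))), fun p ω ω' => ?_⟩
  · exact Primrec.list_map (Primrec.snd.comp Primrec.snd) (Primrec₂.const false)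
  · simp only [hRA]
    simp [initSeg]

/-- The witnessing relation need not be monotone in the prefix length. The two required lengths are
therefore coded as one pair `z`, and the prefixes of length `z` are cut back to each of them; both
components of a pair are at most `z`. -/
theorem and {A B : α → Cantor → Cantor → Prop} (hA : EffOpen A) (hB : EffOpen B) :
    EffOpen fun p ω ω' => A p ω ω' ∧ B p ω ω' := by
  obtain ⟨R, hR, hRA⟩ := hA
  obtain ⟨S, hS, hSB⟩ := hB
  have hl : Primrec fun q : α × List Bool × List Bool => q.2.1.length.unpair :=
    Primrec.unpair.comp (Primrec.list_length.comp (Primrec.fst.comp Primrec.snd))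
  have aux : ∀ g : α × List Bool × List Bool → ℕ, Primrec g →
      Primrec fun q : α × List Bool × List Bool => (q.1, q.2.1.take (g q), q.2.2.take (g q)) :=
    fun g hg => Primrec.pair Primrec.fst (Primrec.pair
      (Primrec.list_take.comp hg (Primrec.fst.comp Primrec.snd))
      (Primrec.list_take.comp hg (Primrec.snd.comp Primrec.snd)))
  refine ⟨_, (hR.comp (aux _ (Primrec.fst.comp hl))).and (hS.comp (aux _ (Primrec.snd.comp hl))),
    fun p ω ω' => ?_⟩
  simp only [hRA, hSB, length_initSeg, take_initSeg _ (Nat.unpair_left_le _),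
    take_initSeg _ (Nat.unpair_right_le _)]
  constructor
  · rintro ⟨⟨x, hx⟩, y, hy⟩
    exact ⟨Nat.pair x y, by simpa using hx, by simpa using hy⟩
  · rintro ⟨z, hx, hy⟩
    exact ⟨⟨_, hx⟩, _, hy⟩

theorem exists_param {A : α × β → Cantor → Cantor → Prop} (hA : EffOpen A) :
    EffOpen fun p ω ω' => ∃ b, A (p, b) ω ω' := by
  obtain ⟨R, hR, hRA⟩ := hA
  have hl : Primrec fun q : α × List Bool × List Bool => q.2.1.length.unpair :=
    Primrec.unpair.comp (Primrec.list_length.comp (Primrec.fst.comp Primrec.snd))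
  have hrel : PrimrecRel fun (b : β) (q : α × List Bool × List Bool) =>
      R ((q.1, b), q.2.1.take q.2.1.length.unpair.2, q.2.2.take q.2.1.length.unpair.2) := by
    refine PrimrecPred.primrecRel (p := fun x : β × α × List Bool × List Bool =>
      R ((x.2.1, x.1), x.2.2.1.take x.2.2.1.length.unpair.2,
        x.2.2.2.take x.2.2.1.length.unpair.2)) (hR.comp ?_)
    have h2 := (Primrec.snd.comp hl).comp
      (Primrec.snd (α := β) (β := α × List Bool × List Bool))
    have h3 := Primrec.snd (α := β) (β := α × List Bool × List Bool)
    exact Primrec.pair (Primrec.pair (Primrec.fst.comp h3) Primrec.fst)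
      (Primrec.pair (Primrec.list_take.comp h2 (Primrec.fst.comp (Primrec.snd.comp h3)))
        (Primrec.list_take.comp h2 (Primrec.snd.comp (Primrec.snd.comp h3))))
  have hdec : Primrec fun q : α × List Bool × List Bool =>
      (decode (α := β) q.2.1.length.unpair.1).toList :=
    Primrec.optionToList.comp (Primrec.decode.comp (Primrec.fst.comp hl))
  refine ⟨_, hrel.exists_mem_list.comp hdec Primrec.id, fun p ω ω' => ?_⟩
  simp only [hRA, length_initSeg, id, take_initSeg _ (Nat.unpair_right_le _), Option.mem_toList]
  constructor
  · rintro ⟨b, z, hz⟩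
    exact ⟨Nat.pair (encode b) z, b, by simp, by simpa using hz⟩
  · rintro ⟨z, b, -, hb⟩
    exact ⟨b, _, hb⟩

theorem of_primrec {R : α × List Bool × List Bool → Prop} (hR : PrimrecPred R) {g : α → ℕ}
    (hg : Primrec g) :
    EffOpen fun p ω ω' => R (p, initSeg ω (g p), initSeg ω' (g p)) := by
  have hg' := hg.comp (Primrec.fst (α := α) (β := List Bool × List Bool))
  refine ⟨fun q => g q.1 ≤ q.2.1.length ∧ R (q.1, q.2.1.take (g q.1), q.2.2.take (g q.1)),
    (Primrec.nat_le.comp hg' (Primrec.list_length.comp (Primrec.fst.comp Primrec.snd))).and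
      (hR.comp (Primrec.pair Primrec.fst (Primrec.pair
        (Primrec.list_take.comp hg' (Primrec.fst.comp Primrec.snd))
        (Primrec.list_take.comp hg' (Primrec.snd.comp Primrec.snd))))), fun p ω ω' => ?_⟩
  simp only [length_initSeg]
  constructor
  · exact fun h => ⟨g p, le_rfl, by simpa [take_initSeg] using h⟩
  · rintro ⟨z, hz, h⟩
    simpa [take_initSeg _ hz] using h

theorem of_primrecPred {R : α → Prop} (hR : PrimrecPred R) : EffOpen fun p _ _ => R p :=
  of_primrec (R := fun q => R q.1) (hR.comp Primrec.fst) (Primrec.const 0)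

theorem of_rePred {W : α → Prop} (hW : REPred W) : EffOpen fun p _ _ => W p := by
  obtain ⟨c, hc⟩ := exists_code_of_rePred hW
  -- The length of the prefix serves as the bound on the number of steps.
  refine ⟨fun q => (c.evaln q.2.1.length (encode q.1)).isSome = true, primrecPred_isSome
    (Code.primrec_evaln.comp (Primrec.pair (Primrec.pair
      (Primrec.list_length.comp (Primrec.fst.comp Primrec.snd)) (Primrec.const c))
      (Primrec.encode.comp Primrec.fst))), fun p ω ω' => ?_⟩
  simpa using hc p

theorem mem_cyl : EffOpen fun (u : List Bool) ω (_ : Cantor) => ω ∈ cyl u :=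
  of_primrec (R := fun q => q.2.1 = q.1)
    (Primrec.eq.comp (Primrec.fst.comp Primrec.snd) Primrec.fst) Primrec.list_length

end EffOpen

/-! ### Lower semicomputability in terms of prefixes -/

theorem lowerSemicomputable_pair_iff {f : Cantor × Cantor → ℝ≥0∞} :
    LowerSemicomputable cylPair f ↔
      EffOpen fun (p : ℕ × ℕ) ω ω' => (p.1 : ℝ≥0∞) / ((p.2 : ℝ≥0∞) + 1) < f (ω, ω') := by
  constructor
  · rintro ⟨W, hW, h⟩
    have h1 := ((EffOpen.of_rePred hW).comp
      (Primrec.pair Primrec.snd Primrec.fst :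
        Primrec fun x : (ℕ × ℕ) × List Bool × List Bool => (x.2, x.1)))
    have h2 := EffOpen.mem_cyl.comp (Primrec.fst.comp Primrec.snd :
        Primrec fun x : (ℕ × ℕ) × List Bool × List Bool => x.2.1)
    have h3 := EffOpen.mem_cyl.swap.comp (Primrec.snd.comp Primrec.snd :
        Primrec fun x : (ℕ × ℕ) × List Bool × List Bool => x.2.2)
    refine (h1.and (h2.and h3)).exists_param.of_iff fun p ω ω' => ?_
    rw [h]
    simp [cylPair]
  · rintro ⟨R, hR, h⟩
    -- `R` is meaningful only for two prefixes of the same length, so only such base sets are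
    -- listed.
    refine ⟨fun x => x.1.1.length = x.1.2.length ∧ R (x.2, x.1), PrimrecPred.computablePred
      (PrimrecPred.and (Primrec.eq.comp
        (Primrec.list_length.comp (Primrec.fst.comp Primrec.fst))
        (Primrec.list_length.comp (Primrec.snd.comp Primrec.fst)))
        (hR.comp (Primrec.pair Primrec.snd Primrec.fst))) |>.to_re, fun a b x => ?_⟩
    refine (h (a, b) x.1 x.2).trans ?_
    constructor
    · rintro ⟨z, hz⟩
      exact ⟨(initSeg x.1 z, initSeg x.2 z), ⟨by simp, hz⟩, mem_cyl_initSeg _ _,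
        mem_cyl_initSeg _ _⟩
    · rintro ⟨⟨u, v⟩, ⟨huv, hz⟩, hu, hv⟩
      refine ⟨u.length, ?_⟩
      have hu' : initSeg x.1 u.length = u := hu
      have hv' : initSeg x.2 u.length = v := by rw [huv]; exact hv
      rwa [hu', hv']

theorem lowerSemicomputable_cond_iff {f : Cantor × Cantor × ℤ → ℝ≥0∞} :
    LowerSemicomputable cylCond f ↔
      EffOpen fun (p : ℕ × ℕ × ℤ) ω ω' =>
        (p.1 : ℝ≥0∞) / ((p.2.1 : ℝ≥0∞) + 1) < f (ω', ω, p.2.2) := by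
  constructor
  · rintro ⟨W, hW, h⟩
    have h1 := ((EffOpen.of_rePred hW).comp
      (Primrec.pair (Primrec.pair (Primrec.fst.comp Primrec.snd) (Primrec.pair
        (Primrec.snd.comp Primrec.snd) (Primrec.snd.comp (Primrec.snd.comp Primrec.fst))))
        (Primrec.pair (Primrec.fst.comp Primrec.fst)
          (Primrec.fst.comp (Primrec.snd.comp Primrec.fst))) :
        Primrec fun x : (ℕ × ℕ × ℤ) × List Bool × List Bool =>
          ((x.2.1, x.2.2, x.1.2.2), x.1.1, x.1.2.1)))
    have h2 := EffOpen.mem_cyl.swap.comp (Primrec.fst.comp Primrec.snd :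
        Primrec fun x : (ℕ × ℕ × ℤ) × List Bool × List Bool => x.2.1)
    have h3 := EffOpen.mem_cyl.comp (Primrec.snd.comp Primrec.snd :
        Primrec fun x : (ℕ × ℕ × ℤ) × List Bool × List Bool => x.2.2)
    refine (h1.and (h2.and h3)).exists_param.of_iff fun p ω ω' => ?_
    rw [h]
    simp only [cylCond, Set.mem_prod, Set.mem_singleton_iff, Prod.exists]
    constructor
    · rintro ⟨v, u, k, hW, hv, hu, rfl⟩
      exact ⟨v, u, hW, hv, hu⟩
    · rintro ⟨v, u, hW, hv, hu⟩
      exact ⟨v, u, _, hW, hv, hu, rfl⟩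
  · rintro ⟨R, hR, h⟩
    refine ⟨fun x => x.1.1.length = x.1.2.1.length ∧
        R ((x.2.1, x.2.2, x.1.2.2), x.1.2.1, x.1.1), PrimrecPred.computablePred
      (PrimrecPred.and (Primrec.eq.comp
        (Primrec.list_length.comp (Primrec.fst.comp Primrec.fst))
        (Primrec.list_length.comp (Primrec.fst.comp (Primrec.snd.comp Primrec.fst))))
        (hR.comp (Primrec.pair (Primrec.pair (Primrec.fst.comp Primrec.snd)
          (Primrec.pair (Primrec.snd.comp Primrec.snd)
            (Primrec.snd.comp (Primrec.snd.comp Primrec.fst))))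
          (Primrec.pair (Primrec.fst.comp (Primrec.snd.comp Primrec.fst))
            (Primrec.fst.comp Primrec.fst))))) |>.to_re, fun a b x => ?_⟩
    obtain ⟨ω', ω, k⟩ := x
    refine (h (a, b, k) ω ω').trans ?_
    constructor
    · rintro ⟨z, hz⟩
      exact ⟨(initSeg ω' z, initSeg ω z, k), ⟨by simp, hz⟩, mem_cyl_initSeg _ _,
        mem_cyl_initSeg _ _, rfl⟩
    · rintro ⟨⟨v, u, l⟩, ⟨huv, hz⟩, hv, hu, hk⟩
      have hk : k = l := hk
      subst hk
      refine ⟨u.length, ?_⟩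
      have hu' : initSeg ω u.length = u := hu
      have hv' : initSeg ω' u.length = v := by
        have : initSeg ω' v.length = v := hv
        rwa [← huv]
      rwa [hu', hv']

theorem lowerSemicomputable_iff {f : Cantor → ℝ≥0∞} :
    LowerSemicomputable cyl f ↔
      EffOpen fun (p : ℕ × ℕ) ω (_ : Cantor) =>
        (p.1 : ℝ≥0∞) / ((p.2 : ℝ≥0∞) + 1) < f ω := by
  constructor
  · rintro ⟨W, hW, h⟩
    have h1 := ((EffOpen.of_rePred hW).comp
      (Primrec.pair Primrec.snd Primrec.fst :
        Primrec fun x : (ℕ × ℕ) × List Bool => (x.2, x.1)))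
    have h2 := EffOpen.mem_cyl.comp (Primrec.snd :
        Primrec fun x : (ℕ × ℕ) × List Bool => x.2)
    refine (h1.and h2).exists_param.of_iff fun p ω ω' => ?_
    rw [h]
  · rintro ⟨R, hR, h⟩
    refine ⟨fun x => R (x.2, x.1, x.1), PrimrecPred.computablePred
        (hR.comp (Primrec.pair Primrec.snd (Primrec.pair Primrec.fst Primrec.fst))) |>.to_re,
        fun a b x => ?_⟩
    refine (h (a, b) x x).trans ?_
    constructor
    · rintro ⟨z, hz⟩
      exact ⟨initSeg x z, hz, mem_cyl_initSeg _ _⟩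
    · rintro ⟨u, hz, hu⟩
      refine ⟨u.length, ?_⟩
      have hu' : initSeg x u.length = u := hu
      rwa [hu']

/-! ### Approximation by step functions with natural values -/

/-- The code `c` halts within `n` steps on the input `x`. -/
def Halts {α : Type*} [Primcodable α] (c : Code) (n : ℕ) (x : α) : Prop :=
  (c.evaln n (encode x)).isSome = true

instance {α : Type*} [Primcodable α] (c : Code) (n : ℕ) (x : α) : Decidable (Halts c n x) := by
  unfold Halts; infer_instance

theorem primrecPred_halts {α : Type*} [Primcodable α] :
    PrimrecPred fun x : Code × ℕ × α => Halts x.1 x.2.1 x.2.2 :=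
  primrecPred_isSome (Code.primrec_evaln.comp (Primrec.pair
    (Primrec.pair (Primrec.fst.comp Primrec.snd) Primrec.fst)
    (Primrec.encode.comp (Primrec.snd.comp Primrec.snd))))

theorem Halts.mono {α : Type*} [Primcodable α] {c : Code} {m n : ℕ} (h : m ≤ n) {x : α}
    (hm : Halts c m x) : Halts c n x := by
  obtain ⟨y, hy⟩ := Option.isSome_iff_exists.1 hm
  exact Option.isSome_iff_exists.2 ⟨y, Code.evaln_mono h hy⟩

/-- The code `c` accepts, within `n` steps, some common truncation of `u` and `v` to length at most
`n`, given the natural number `a` and the integer `k`. -/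
def Accepts (c : Code) (n : ℕ) (u v : List Bool) (k : ℤ) (a : ℕ) : Prop :=
  ∃ z < n + 1, Halts c n ((a, k), u.take z, v.take z)

instance (c : Code) (n : ℕ) (u v : List Bool) (k : ℤ) : DecidablePred (Accepts c n u v k) :=
  fun _ => by unfold Accepts; infer_instance

/-- The number of thresholds `a < n` which the code `c` accepts at stage `n`. -/
def level (c : Code) (n : ℕ) (u v : List Bool) (k : ℤ) : ℕ :=
  ((List.range n).filter fun a => Accepts c n u v k a).length

theorem primrec_level :
    Primrec fun x : Code × ℕ × List Bool × List Bool × ℤ =>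
      level x.1 x.2.1 x.2.2.1 x.2.2.2.1 x.2.2.2.2 := by
  have h0 : PrimrecRel fun (z : ℕ) (y : ℕ × Code × ℕ × List Bool × List Bool × ℤ) =>
      Halts y.2.1 y.2.2.1 ((y.1, y.2.2.2.2.2), y.2.2.2.1.take z, y.2.2.2.2.1.take z) := by
    have z := Primrec.fst (α := ℕ) (β := ℕ × Code × ℕ × List Bool × List Bool × ℤ)
    have y := Primrec.snd (α := ℕ) (β := ℕ × Code × ℕ × List Bool × List Bool × ℤ)
    have a := Primrec.fst.comp y
    have x := Primrec.snd.comp y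
    have c := Primrec.fst.comp x
    have n := Primrec.fst.comp (Primrec.snd.comp x)
    have u := Primrec.fst.comp (Primrec.snd.comp (Primrec.snd.comp x))
    have v := Primrec.fst.comp (Primrec.snd.comp (Primrec.snd.comp (Primrec.snd.comp x)))
    have k := Primrec.snd.comp (Primrec.snd.comp (Primrec.snd.comp (Primrec.snd.comp x)))
    exact (primrecPred_halts.comp (Primrec.pair c (Primrec.pair n
      (Primrec.pair (Primrec.pair a k) (Primrec.pair (Primrec.list_take.comp z u)
        (Primrec.list_take.comp z v)))))).primrecRel
  have h1 : PrimrecRel fun (a : ℕ) (x : Code × ℕ × List Bool × List Bool × ℤ) =>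
      Accepts x.1 x.2.1 x.2.2.1 x.2.2.2.1 x.2.2.2.2 a := by
    refine PrimrecPred.primrecRel (p := fun y : ℕ × Code × ℕ × List Bool × List Bool × ℤ =>
      Accepts y.2.1 y.2.2.1 y.2.2.2.1 y.2.2.2.2.1 y.2.2.2.2.2 y.1) ?_
    have n := Primrec.succ.comp (Primrec.fst.comp (Primrec.snd.comp (Primrec.snd
      (α := ℕ) (β := Code × ℕ × List Bool × List Bool × ℤ))))
    refine (PrimrecRel.comp h0.exists_mem_list (Primrec.list_range.comp n) Primrec.id).of_eq ?_
    simp [Accepts]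
  exact Primrec.list_length.comp (h1.listFilter.comp
    (Primrec.list_range.comp (Primrec.fst.comp Primrec.snd)) Primrec.id)

theorem level_eq_card (c : Code) (n : ℕ) (u v : List Bool) (k : ℤ) :
    level c n u v k = ((Finset.range n).filter (Accepts c n u v k)).card := by
  rfl

/-- The search through all shorter truncations in `Accepts` is there for this: an old witness stays
available when the prefixes grow. -/
theorem Accepts.mono {c : Code} {m n : ℕ} (h : m ≤ n) {ω ω' : Cantor} {k : ℤ} {a : ℕ}
    (ha : Accepts c m (initSeg ω m) (initSeg ω' m) k a) :
    Accepts c n (initSeg ω n) (initSeg ω' n) k a := by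
  obtain ⟨z, hz, hs⟩ := ha
  refine ⟨z, by omega, ?_⟩
  rw [take_initSeg _ (by omega), take_initSeg _ (by omega)] at hs ⊢
  exact hs.mono h

theorem monotone_level (c : Code) (ω ω' : Cantor) (k : ℤ) :
    Monotone fun n => level c n (initSeg ω n) (initSeg ω' n) k := by
  intro m n h
  simp only [level_eq_card]
  refine Finset.card_le_card fun a => ?_
  simp only [Finset.mem_filter, Finset.mem_range]
  exact fun ⟨ha, hA⟩ => ⟨by omega, hA.mono h⟩

/-- The code `c` semi-decides the property `A`, with the two sequences as oracles. -/
def Represents (c : Code) (A : ℕ × ℤ → Cantor → Cantor → Prop) : Prop :=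
  ∀ a k ω ω', A (a, k) ω ω' ↔ ∃ n, Accepts c n (initSeg ω n) (initSeg ω' n) k a

theorem EffOpen.exists_represents {A : ℕ × ℤ → Cantor → Cantor → Prop} (hA : EffOpen A) :
    ∃ c, Represents c A := by
  obtain ⟨R, hR, h⟩ := hA
  obtain ⟨c, hc⟩ := exists_code_of_rePred hR.computablePred.to_re
  refine ⟨c, fun a k ω ω' => ?_⟩
  rw [h]
  simp only [hc]
  constructor
  · rintro ⟨z, s, hs⟩
    refine ⟨max z s, z, by omega, ?_⟩
    rw [take_initSeg _ (by omega), take_initSeg _ (by omega)]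
    exact Halts.mono (le_max_right _ _) hs
  · rintro ⟨n, z, hz, hs⟩
    rw [take_initSeg _ (by omega), take_initSeg _ (by omega)] at hs
    exact ⟨z, n, hs⟩

/-- The limit of the levels, as a function of the two sequences. -/
noncomputable def limLevel (c : Code) (ω ω' : Cantor) (k : ℤ) : ℝ≥0∞ :=
  ⨆ n, (level c n (initSeg ω n) (initSeg ω' n) k : ℝ≥0∞)

theorem Represents.le_limLevel {c : Code} {A : ℕ × ℤ → Cantor → Cantor → Prop}
    (hc : Represents c A) {x : ℝ≥0∞} {ω ω' : Cantor} {k : ℤ}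
    (hx : ∀ a : ℕ, (a : ℝ≥0∞) < x ↔ A (a, k) ω ω') : x ≤ limLevel c ω ω' k := by
  -- If `a < x`, then the `a + 1` thresholds `0, …, a` are all accepted by some common stage `M`.
  have key : ∀ a : ℕ, (a : ℝ≥0∞) < x → ((a + 1 : ℕ) : ℝ≥0∞) ≤ limLevel c ω ω' k := by
    intro a ha
    have h1 : ∀ b, ∃ n, b ≤ a → Accepts c n (initSeg ω n) (initSeg ω' n) k b := by
      intro b
      by_cases hb : b ≤ a
      · have : (b : ℝ≥0∞) < x := lt_of_le_of_lt (by exact_mod_cast hb) ha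
        obtain ⟨n, hn⟩ := (hc b k ω ω').1 ((hx b).1 this)
        exact ⟨n, fun _ => hn⟩
      · exact ⟨0, fun h => absurd h hb⟩
    choose N hN using h1
    let M := (Finset.range (a + 1)).sup N + (a + 1)
    refine le_trans ?_ (le_iSup _ M)
    norm_cast
    rw [level_eq_card]
    calc a + 1 = (Finset.range (a + 1)).card := by simp
      _ ≤ _ := by
        refine Finset.card_le_card fun b hb => ?_
        have hb' := Finset.mem_range.1 hb
        have hle : N b ≤ (Finset.range (a + 1)).sup N := Finset.le_sup hb
        simp only [Finset.mem_filter, Finset.mem_range]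
        exact ⟨by omega, (hN b (by omega)).mono (by omega)⟩
  by_contra! hlt
  have hfin : limLevel c ω ω' k ≠ ⊤ := hlt.ne_top
  set y := (limLevel c ω ω' k).toNNReal with hy
  have hyl : (y : ℝ≥0∞) = limLevel c ω ω' k := ENNReal.coe_toNNReal hfin
  have h1 : ((⌊y⌋₊ : ℕ) : ℝ≥0∞) ≤ y := by
    have := Nat.floor_le (zero_le (a := y))
    exact_mod_cast this
  have h2 := key ⌊y⌋₊ (lt_of_le_of_lt h1 (hyl ▸ hlt))
  rw [← hyl] at h2
  have h3 := Nat.lt_floor_add_one y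
  have h4 : ((⌊y⌋₊ + 1 : ℕ) : ℝ≥0) ≤ y := by exact_mod_cast h2
  push_cast at h4
  exact absurd h3 (not_lt.2 h4)

theorem Represents.limLevel_le {c : Code} {A : ℕ × ℤ → Cantor → Cantor → Prop}
    (hc : Represents c A) {x : ℝ≥0∞} {ω ω' : Cantor} {k : ℤ}
    (hx : ∀ a : ℕ, (a : ℝ≥0∞) < x ↔ A (a, k) ω ω') : limLevel c ω ω' k ≤ x + 1 := by
  rcases eq_or_ne x ⊤ with rfl | hfin
  · simp
  refine iSup_le fun n => ?_
  lift x to ℝ≥0 using hfin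
  -- Every counted threshold is a natural number below `x`, and there are `⌈x⌉₊` of those.
  have : level c n (initSeg ω n) (initSeg ω' n) k ≤ ⌈x⌉₊ := by
    rw [level_eq_card]
    calc _ ≤ (Finset.range ⌈x⌉₊).card := by
          refine Finset.card_le_card fun a => ?_
          simp only [Finset.mem_filter, Finset.mem_range]
          rintro ⟨-, ha⟩
          have h1 := (hx a).2 ((hc a k ω ω').2 ⟨n, ha⟩)
          rw [Nat.lt_ceil]
          exact_mod_cast h1
      _ = _ := by simp
  have h2 : (⌈x⌉₊ : ℝ≥0) ≤ x + 1 := (Nat.ceil_lt_add_one zero_le).le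
  calc ((level c n (initSeg ω n) (initSeg ω' n) k : ℕ) : ℝ≥0∞) ≤ (⌈x⌉₊ : ℝ≥0∞) := by
        exact_mod_cast this
    _ ≤ _ := by exact_mod_cast h2

/-! ### Primitive recursive bounds for the kernel -/

theorem primrec_nat_pow : Primrec₂ ((· ^ ·) : ℕ → ℕ → ℕ) :=
  Primrec₂.unpaired'.1 Nat.Primrec.pow

theorem primrec_list_sum : Primrec (List.sum : List ℕ → ℕ) :=
  (Primrec.list_foldr Primrec.id (Primrec.const 0)
    (Primrec.nat_add.comp (Primrec.fst.comp Primrec.snd)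
      (Primrec.snd.comp Primrec.snd)).to₂).of_eq fun l => by simp [List.sum_eq_foldr]

theorem exists_code_of_computable {α σ : Type*} [Primcodable α] [Primcodable σ] {f : α → σ}
    (hf : Computable f) : ∃ c : Code, ∀ a, c.eval (encode a) = Part.some (encode (f a)) := by
  obtain ⟨c, hc⟩ := Code.exists_code.1 hf
  exact ⟨c, fun a => by rw [hc]; simp⟩

/-- The output of the code `c` on the input `x` after `n` steps. -/
def output {α : Type*} (σ : Type*) [Primcodable α] [Primcodable σ] (c : Code) (n : ℕ) (x : α) :
    Option σ :=
  (c.evaln n (encode x)).bind decode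

theorem primrec_output {α σ : Type*} [Primcodable α] [Primcodable σ] (c : Code) :
    Primrec fun x : ℕ × α => output σ c x.1 x.2 :=
  Primrec.option_bind (Code.primrec_evaln.comp (Primrec.pair
    (Primrec.pair Primrec.fst (Primrec.const c)) (Primrec.encode.comp Primrec.snd)))
    (Primrec.decode.comp Primrec.snd).to₂

/-- The first answer, within `|w|` steps, of the oracle machine with code `c` which has access to
prefixes of `w`. -/
def answer (c : Code) (w v : List Bool) (m : ℕ) : Option ℕ :=
  ((List.range (w.length + 1)).filterMap fun z =>
    (output (Option ℕ) c w.length (w.take z, v, m)).bind id).head?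

theorem primrec_answer (c : Code) :
    Primrec fun x : List Bool × List Bool × ℕ => answer c x.1 x.2.1 x.2.2 := by
  have hl : Primrec fun x : List Bool × List Bool × ℕ => x.1.length :=
    Primrec.list_length.comp Primrec.fst
  have h : Primrec fun y : (List Bool × List Bool × ℕ) × ℕ =>
      (output (Option ℕ) c y.1.1.length (y.1.1.take y.2, y.1.2.1, y.1.2.2)) :=
    (primrec_output c).comp (Primrec.pair (hl.comp Primrec.fst) (Primrec.pair
      (Primrec.list_take.comp Primrec.snd (Primrec.fst.comp Primrec.fst))
      (Primrec.snd.comp Primrec.fst)))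
  exact Primrec.list_head?.comp (Primrec.listFilterMap
    (Primrec.list_range.comp (Primrec.succ.comp hl))
    (Primrec.option_bind h (Primrec.id.comp Primrec.snd).to₂).to₂)

/-- Primitive recursive lower and upper bounds for the values of a uniformly computable family of
measures. -/
theorem exists_primrec_bounds {κ : Kernel Cantor Cantor} [IsMarkovKernel κ]
    (hκ : IsUniformlyComputable κ) :
    ∃ U D : List Bool × List Bool × ℕ → ℕ, Primrec U ∧ Primrec D ∧
      (∀ ω s v m, (κ ω).real (cyl v) * 2 ^ m ≤ U (initSeg ω s, v, m)) ∧
      (∀ ω s v m, (D (initSeg ω s, v, m) : ℝ) ≤ (κ ω).real (cyl v) * 2 ^ m) ∧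
      ∀ ω v m, ∀ᶠ s in Filter.atTop, U (initSeg ω s, v, m) ≤ D (initSeg ω s, v, m) + 2 := by
  obtain ⟨Φ, hΦ, h⟩ := hκ
  obtain ⟨c, hc⟩ := exists_code_of_computable (α := List Bool × List Bool × ℕ)
    (f := fun p => Φ p.1 p.2) hΦ
  have hout : ∀ n (x : List Bool × List Bool × ℕ) y, output (Option ℕ) c n x = some y →
      Φ x.1 x.2 = y := by
    intro n x y hy
    obtain ⟨r, hr, hd⟩ := Option.bind_eq_some_iff.1 hy
    have h1 := Code.evaln_sound (Option.mem_def.2 hr)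
    rw [hc, Part.mem_some_iff] at h1
    rw [h1, encodek] at hd
    simpa using hd
  have hsound : ∀ ω s v m a, answer c (initSeg ω s) v m = some a →
      |(κ ω).real (cyl v) - (a : ℝ) / 2 ^ m| ≤ 1 / 2 ^ m := by
    intro ω s v m a ha
    have h1 := List.mem_of_mem_head? (Option.mem_def.2 ha)
    obtain ⟨z, hz, hz'⟩ := List.mem_filterMap.1 h1
    obtain ⟨y, hy, hya⟩ := Option.bind_eq_some_iff.1 hz'
    have hzs : z ≤ s := by simpa [Nat.lt_succ_iff] using hz
    rw [take_initSeg _ hzs] at hy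
    have h2 := hout _ _ _ hy
    simp only [id] at hya
    rw [hya] at h2
    exact (h ω v m).2 z a h2
  have hcomplete : ∀ ω v m, ∀ᶠ s in Filter.atTop, ∃ a, answer c (initSeg ω s) v m = some a := by
    intro ω v m
    obtain ⟨z, a, hza⟩ := (h ω v m).1
    have h1 : encode (Φ (initSeg ω z) (v, m)) ∈ c.eval (encode (initSeg ω z, v, m)) := by
      rw [hc]; exact Part.mem_some _
    obtain ⟨k, hk⟩ := Code.evaln_complete.1 h1
    filter_upwards [Filter.eventually_ge_atTop (max z k)] with s hs
    have h2 := Code.evaln_mono (le_trans (le_max_right _ _) hs) hk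
    have h3 : a ∈ (List.range ((initSeg ω s).length + 1)).filterMap fun z =>
        (output (Option ℕ) c (initSeg ω s).length ((initSeg ω s).take z, v, m)).bind id := by
      have hzs : z ≤ s := le_trans (le_max_left _ _) hs
      refine List.mem_filterMap.2 ⟨z, by simp; omega, ?_⟩
      rw [take_initSeg _ hzs, length_initSeg, output, Option.mem_def.1 h2, hza, Option.bind_some,
        encodek]
      rfl
    have h4 := List.isSome_head?.2 (List.ne_nil_of_mem h3)
    exact Option.isSome_iff_exists.1 h4
  -- An answer `a` is off by at most one in units of `2⁻ᵐ`, so `a + 1` and the truncated `a - 1` are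
  -- bounds. Before an answer is found, the trivial bounds `2 ^ m` and `0` are valid because `κ ω`
  -- is a probability measure.
  refine ⟨fun x => ((answer c x.1 x.2.1 x.2.2).map Nat.succ).getD (2 ^ x.2.2),
    fun x => ((answer c x.1 x.2.1 x.2.2).map Nat.pred).getD 0, ?_, ?_, ?_, ?_, ?_⟩
  · exact Primrec.option_getD.comp
      (Primrec.option_map (primrec_answer c) (Primrec.succ.comp Primrec.snd).to₂)
      (primrec_nat_pow.comp (Primrec.const 2) (Primrec.snd.comp Primrec.snd))
  · exact Primrec.option_getD.comp
      (Primrec.option_map (primrec_answer c) (Primrec.pred.comp Primrec.snd).to₂)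
      (Primrec.const 0)
  · intro ω s v m
    have h2 : (0 : ℝ) < 2 ^ m := by positivity
    rcases ha : answer c (initSeg ω s) v m with _ | a
    · simp [ha]
    · have h1 := (abs_le.1 (hsound _ _ _ _ _ ha)).2
      rw [sub_le_iff_le_add, ← add_div, le_div_iff₀ h2] at h1
      simp [ha]; linarith
  · intro ω s v m
    have h2 : (0 : ℝ) < 2 ^ m := by positivity
    rcases ha : answer c (initSeg ω s) v m with _ | a
    · simp [ha]
    · have h1 := (abs_le.1 (hsound _ _ _ _ _ ha)).1
      rw [le_sub_iff_add_le, neg_add_eq_sub, ← sub_div, div_le_iff₀ h2] at h1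
      rcases a with _ | a
      · simp [ha]
      · push_cast at h1
        simp [ha]; linarith
  · intro ω v m
    filter_upwards [hcomplete ω v m] with s ⟨a, ha⟩
    simp [ha]; omega

/-! ### Integrals of step functions as finite sums -/

/-- All strings of length `n`. -/
def strings (n : ℕ) : List (List Bool) :=
  n.rec [[]] fun _ l => l.map (List.cons true) ++ l.map (List.cons false)

theorem primrec_strings : Primrec strings := by
  have hc : ∀ b : Bool, Primrec₂ fun (p : ℕ × List (List Bool)) (l : List Bool) => b :: l :=
    fun b => (Primrec.list_cons.comp (Primrec.const b) Primrec.snd).to₂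
  exact Primrec.nat_rec₁ _ (Primrec.list_append.comp
    (Primrec.list_map Primrec.snd (hc true)) (Primrec.list_map Primrec.snd (hc false))).to₂

theorem mem_strings {n : ℕ} {v : List Bool} : v ∈ strings n ↔ v.length = n := by
  induction n generalizing v with
  | zero => simp [strings]
  | succ n ih =>
    have : strings (n + 1) =
      (strings n).map (List.cons true) ++ (strings n).map (List.cons false) := rfl
    rw [this]
    rcases v with _ | ⟨b, v⟩
    · simp
    · cases b <;> simp [ih]

theorem nodup_strings (n : ℕ) : (strings n).Nodup := by
  induction n with
  | zero => simp [strings]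
  | succ n ih =>
    have : strings (n + 1) =
      (strings n).map (List.cons true) ++ (strings n).map (List.cons false) := rfl
    rw [this, List.nodup_append]
    refine ⟨ih.map List.cons_injective, ih.map List.cons_injective, ?_⟩
    simp only [List.mem_map]
    rintro _ ⟨a, -, rfl⟩ _ ⟨b, -, rfl⟩
    simp

theorem measurable_initSeg_comp {β : Type*} [MeasurableSpace β] (n : ℕ) (g : List Bool → β) :
    Measurable fun ω : Cantor => g (initSeg ω n) := by
  have h : (fun ω : Cantor => g (initSeg ω n)) =
      (fun x : Fin n → Bool => g (List.ofFn x)) ∘ fun ω i => ω i := by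
    funext ω
    simp only [Function.comp, initSeg]
    congr 1
    apply List.ext_getElem <;> simp
  rw [h]
  exact (measurable_of_finite _).comp (measurable_pi_lambda _ fun i => measurable_pi_apply _)

theorem measurableSet_cyl (u : List Bool) : MeasurableSet (cyl u) :=
  measurableSet_setOfPred.2 (measurable_initSeg_comp u.length fun v => v = u)

theorem lintegral_initSeg (μ : Measure Cantor) [IsFiniteMeasure μ] (n : ℕ) (g : List Bool → ℕ) :
    ∫⁻ ω, (g (initSeg ω n) : ℝ≥0∞) ∂μ =
      ENNReal.ofReal (∑ v ∈ (strings n).toFinset, (g v : ℝ) * μ.real (cyl v)) := by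
  have h : ∀ ω : Cantor, (g (initSeg ω n) : ℝ≥0∞) =
      ∑ v ∈ (strings n).toFinset, (g v : ℝ≥0∞) * (cyl v).indicator 1 ω := by
    intro ω
    rw [Finset.sum_eq_single (initSeg ω n)]
    · simp [mem_cyl_initSeg]
    · intro v hv hne
      have hv' : v.length = n := mem_strings.1 (List.mem_toFinset.1 hv)
      have : ω ∉ cyl v := fun h => hne (by rw [← hv']; exact (mem_cyl_iff.1 h).symm)
      simp [this]
    · intro hn
      exact absurd (List.mem_toFinset.2 (mem_strings.2 (length_initSeg ω n))) hn
  simp only [h]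
  rw [lintegral_finsetSum _ fun v _ =>
    (measurable_one.indicator (measurableSet_cyl v)).const_mul _,
    ENNReal.ofReal_sum_of_nonneg fun v _ => by positivity]
  refine Finset.sum_congr rfl fun v _ => ?_
  rw [lintegral_const_mul _ (measurable_one.indicator (measurableSet_cyl v)),
    lintegral_indicator_one (measurableSet_cyl v), ENNReal.ofReal_mul (by positivity)]
  simp

section Bounds

variable {ι : Type*} (S : Finset ι) (h : ι → ℕ) (x : ι → ℝ) (U D : ℕ → ℕ → ι → ℕ)

theorem sum_mul_le_sum_mul {y : ι → ℕ} {r : ℝ} (hy : ∀ v, x v * r ≤ y v) :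
    (∑ v ∈ S, (h v : ℝ) * x v) * r ≤ ((∑ v ∈ S, h v * y v : ℕ) : ℝ) := by
  push_cast
  rw [Finset.sum_mul]
  refine Finset.sum_le_sum fun v _ => ?_
  rw [mul_assoc]
  exact mul_le_mul_of_nonneg_left (hy v) (Nat.cast_nonneg _)

theorem sum_mul_le_mul_sum {y : ι → ℕ} {r : ℝ} (hy : ∀ v, (y v : ℝ) ≤ x v * r) :
    ((∑ v ∈ S, h v * y v : ℕ) : ℝ) ≤ (∑ v ∈ S, (h v : ℝ) * x v) * r := by
  push_cast
  rw [Finset.sum_mul]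
  refine Finset.sum_le_sum fun v _ => ?_
  rw [mul_assoc]
  exact mul_le_mul_of_nonneg_left (hy v) (Nat.cast_nonneg _)

variable {x U D}

theorem exists_sum_bounds
    (hD : ∀ s m v, (D s m v : ℝ) ≤ x v * 2 ^ m) (hU : ∀ s m v, x v * 2 ^ m ≤ U s m v)
    (hUD : ∀ m v, ∀ᶠ s in Filter.atTop, U s m v ≤ D s m v + 2) {ε : ℝ} (hε : 0 < ε) :
    ∃ s m, ((∑ v ∈ S, h v * U s m v : ℕ) : ℝ) < (∑ v ∈ S, (h v : ℝ) * x v + ε) * 2 ^ m ∧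
      (∑ v ∈ S, (h v : ℝ) * x v - ε) * 2 ^ m < ((∑ v ∈ S, h v * D s m v : ℕ) : ℝ) := by
  -- The upper and lower sums will differ by at most `2 * ∑ h v`; `m` is chosen to make this less
  -- than `ε * 2 ^ m`.
  obtain ⟨m, hm⟩ := pow_unbounded_of_one_lt ((2 * ∑ v ∈ S, (h v : ℝ)) / ε) one_lt_two
  rw [div_lt_iff₀ hε] at hm
  have h1 : ∀ᶠ s in Filter.atTop, ∀ v ∈ S, U s m v ≤ D s m v + 2 :=
    (Filter.eventually_all_finset S).2 fun v _ => hUD m v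
  obtain ⟨s, hs⟩ := h1.exists
  refine ⟨s, m, ?_⟩
  have h2 : ((∑ v ∈ S, h v * U s m v : ℕ) : ℝ) ≤
      ((∑ v ∈ S, h v * D s m v : ℕ) : ℝ) + 2 * ∑ v ∈ S, (h v : ℝ) := by
    push_cast
    rw [Finset.mul_sum, ← Finset.sum_add_distrib]
    refine Finset.sum_le_sum fun v hv => ?_
    have : (U s m v : ℝ) ≤ D s m v + 2 := by exact_mod_cast hs v hv
    nlinarith [(Nat.cast_nonneg (h v) : (0 : ℝ) ≤ h v)]
  have h3 := sum_mul_le_mul_sum S h x (hD s m)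
  have h4 := sum_mul_le_sum_mul S h x (hU s m)
  constructor <;> nlinarith

theorem sum_lt_iff_exists
    (hD : ∀ s m v, (D s m v : ℝ) ≤ x v * 2 ^ m) (hU : ∀ s m v, x v * 2 ^ m ≤ U s m v)
    (hUD : ∀ m v, ∀ᶠ s in Filter.atTop, U s m v ≤ D s m v + 2) (L : ℕ) :
    ∑ v ∈ S, (h v : ℝ) * x v < L ↔ ∃ s m, ∑ v ∈ S, h v * U s m v < L * 2 ^ m := by
  constructor
  · intro hlt
    obtain ⟨s, m, hs, -⟩ := exists_sum_bounds S h hD hU hUD (sub_pos.2 hlt)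
    rw [add_sub_cancel] at hs
    exact ⟨s, m, by exact_mod_cast hs⟩
  · rintro ⟨s, m, hs⟩
    have h4 := sum_mul_le_sum_mul S h x (hU s m)
    have hs' : ((∑ v ∈ S, h v * U s m v : ℕ) : ℝ) < L * 2 ^ m := by exact_mod_cast hs
    exact lt_of_mul_lt_mul_right (h4.trans_lt hs') (by positivity)

theorem lt_sum_iff_exists
    (hD : ∀ s m v, (D s m v : ℝ) ≤ x v * 2 ^ m) (hU : ∀ s m v, x v * 2 ^ m ≤ U s m v)
    (hUD : ∀ m v, ∀ᶠ s in Filter.atTop, U s m v ≤ D s m v + 2) (a b : ℕ) :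
    (a : ℝ) / (b + 1) < ∑ v ∈ S, (h v : ℝ) * x v ↔
      ∃ s m, a * 2 ^ m < (b + 1) * ∑ v ∈ S, h v * D s m v := by
  have hb : (0 : ℝ) < b + 1 := by positivity
  constructor
  · intro hlt
    obtain ⟨s, m, -, hs⟩ := exists_sum_bounds S h hD hU hUD (sub_pos.2 hlt)
    rw [sub_sub_cancel, div_mul_eq_mul_div, div_lt_iff₀' hb] at hs
    exact ⟨s, m, by exact_mod_cast hs⟩
  · rintro ⟨s, m, hs⟩
    have h3 := sum_mul_le_mul_sum S h x (hD s m)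
    have hs' : (a : ℝ) * 2 ^ m < (b + 1) * ((∑ v ∈ S, h v * D s m v : ℕ) : ℝ) := by
      exact_mod_cast hs
    rw [div_lt_iff₀' hb]
    refine lt_of_mul_lt_mul_right (hs'.trans_le ?_) (by positivity : (0 : ℝ) ≤ 2 ^ m)
    rw [mul_assoc]
    exact mul_le_mul_of_nonneg_left h3 hb.le

end Bounds

/-! ### Effective comparison of integrals with rationals -/

/-- The integral of the level at stage `n`. -/
noncomputable def levelIntegral (κ : Kernel Cantor Cantor) (c : Code) (n : ℕ) (ω : Cantor)
    (k : ℤ) : ℝ≥0∞ :=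
  ∫⁻ ω', (level c n (initSeg ω n) (initSeg ω' n) k : ℝ≥0∞) ∂(κ ω)

/-- A finite sum approximating the integral of the level. -/
def levelSum (U : List Bool × List Bool × ℕ → ℕ) (c : Code) (n : ℕ) (k : ℤ) (s m : ℕ)
    (w : List Bool) : ℕ :=
  ((strings n).map fun v => level c n (w.take n) v k * U (w.take s, v, m)).sum

theorem primrec_levelSum {U : List Bool × List Bool × ℕ → ℕ} (hU : Primrec U) :
    Primrec fun x : Code × ℕ × ℤ × ℕ × ℕ × List Bool =>
      levelSum U x.1 x.2.1 x.2.2.1 x.2.2.2.1 x.2.2.2.2.1 x.2.2.2.2.2 := by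
  have x := Primrec.fst (α := Code × ℕ × ℤ × ℕ × ℕ × List Bool) (β := List Bool)
  have v := Primrec.snd (α := Code × ℕ × ℤ × ℕ × ℕ × List Bool) (β := List Bool)
  have c := Primrec.fst.comp x
  have n := Primrec.fst.comp (Primrec.snd.comp x)
  have k := Primrec.fst.comp (Primrec.snd.comp (Primrec.snd.comp x))
  have s := Primrec.fst.comp (Primrec.snd.comp (Primrec.snd.comp (Primrec.snd.comp x)))
  have m := Primrec.fst.comp (Primrec.snd.comp (Primrec.snd.comp
    (Primrec.snd.comp (Primrec.snd.comp x))))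
  have w := Primrec.snd.comp (Primrec.snd.comp (Primrec.snd.comp
    (Primrec.snd.comp (Primrec.snd.comp x))))
  have h1 := primrec_level.comp (Primrec.pair c (Primrec.pair n
    (Primrec.pair (Primrec.list_take.comp n w) (Primrec.pair v k))))
  have h2 := hU.comp (Primrec.pair (Primrec.list_take.comp s w) (Primrec.pair v m))
  have h3 := Primrec.nat_mul.comp h1 h2
  exact primrec_list_sum.comp (Primrec.list_map
    (primrec_strings.comp (Primrec.fst.comp Primrec.snd)) h3.to₂)

theorem levelSum_initSeg (U : List Bool × List Bool × ℕ → ℕ) (c : Code) (n : ℕ) (k : ℤ)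
    (s m : ℕ) (ω : Cantor) :
    levelSum U c n k s m (initSeg ω (n + s)) =
      ∑ v ∈ (strings n).toFinset, level c n (initSeg ω n) v k * U (initSeg ω s, v, m) := by
  rw [levelSum, take_initSeg _ (by omega), take_initSeg _ (by omega),
    List.sum_toFinset _ (nodup_strings n)]

theorem effOpen_levelIntegral_lt {κ : Kernel Cantor Cantor} [IsMarkovKernel κ]
    (hκ : IsUniformlyComputable κ) :
    EffOpen fun (p : Code × ℕ × ℤ × ℕ) ω (_ : Cantor) =>
      levelIntegral κ p.1 p.2.1 ω p.2.2.1 < p.2.2.2 := by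
  obtain ⟨U, D, hU, -, hκU, hκD, hUD⟩ := exists_primrec_bounds hκ
  have hR : PrimrecPred fun q : ((Code × ℕ × ℤ × ℕ) × ℕ × ℕ) × List Bool × List Bool =>
      levelSum U q.1.1.1 q.1.1.2.1 q.1.1.2.2.1 q.1.2.1 q.1.2.2 q.2.1 <
        q.1.1.2.2.2 * 2 ^ q.1.2.2 := by
    have p := Primrec.fst.comp (Primrec.fst (α := (Code × ℕ × ℤ × ℕ) × ℕ × ℕ)
      (β := List Bool × List Bool))
    have sm := Primrec.snd.comp (Primrec.fst (α := (Code × ℕ × ℤ × ℕ) × ℕ × ℕ)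
      (β := List Bool × List Bool))
    have w := Primrec.fst.comp (Primrec.snd (α := (Code × ℕ × ℤ × ℕ) × ℕ × ℕ)
      (β := List Bool × List Bool))
    have p2 := Primrec.snd.comp p
    have p3 := Primrec.snd.comp p2
    have h1 := (primrec_levelSum hU).comp (Primrec.pair (Primrec.fst.comp p)
      (Primrec.pair (Primrec.fst.comp p2) (Primrec.pair (Primrec.fst.comp p3)
        (Primrec.pair (Primrec.fst.comp sm) (Primrec.pair (Primrec.snd.comp sm) w)))))
    exact Primrec.nat_lt.comp h1 (Primrec.nat_mul.comp (Primrec.snd.comp p3)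
      (primrec_nat_pow.comp (Primrec.const 2) (Primrec.snd.comp sm)))
  -- A prefix of length `n + s` suffices both for the level (`n` bits) and for the bounds on the
  -- measure (`s` bits).
  have hg : Primrec fun q : (Code × ℕ × ℤ × ℕ) × ℕ × ℕ => q.1.2.1 + q.2.1 :=
    Primrec.nat_add.comp (Primrec.fst.comp (Primrec.snd.comp Primrec.fst))
      (Primrec.fst.comp Primrec.snd)
  refine (EffOpen.of_primrec hR hg).exists_param.of_iff ?_
  rintro ⟨c, n, k, L⟩ ω -
  simp only [levelSum_initSeg, Prod.exists, levelIntegral, lintegral_initSeg (κ ω) n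
    (fun v => level c n (initSeg ω n) v k)]
  rw [← ENNReal.ofReal_natCast, ENNReal.ofReal_lt_ofReal_iff_of_nonneg (by positivity)]
  exact sum_lt_iff_exists _ _ (U := fun s m v => U (initSeg ω s, v, m))
    (D := fun s m v => D (initSeg ω s, v, m)) (fun s m v => hκD ω s v m)
    (fun s m v => hκU ω s v m) (fun m v => hUD ω v m) L

theorem effOpen_lt_levelIntegral {κ : Kernel Cantor Cantor} [IsMarkovKernel κ]
    (hκ : IsUniformlyComputable κ) :
    EffOpen fun (p : Code × ℕ × ℤ × ℕ × ℕ) ω (_ : Cantor) =>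
      (p.2.2.2.1 : ℝ≥0∞) / ((p.2.2.2.2 : ℝ≥0∞) + 1) < levelIntegral κ p.1 p.2.1 ω p.2.2.1 := by
  obtain ⟨U, D, -, hD, hκU, hκD, hUD⟩ := exists_primrec_bounds hκ
  have hR : PrimrecPred fun q : ((Code × ℕ × ℤ × ℕ × ℕ) × ℕ × ℕ) × List Bool × List Bool =>
      q.1.1.2.2.2.1 * 2 ^ q.1.2.2 < (q.1.1.2.2.2.2 + 1) *
        levelSum D q.1.1.1 q.1.1.2.1 q.1.1.2.2.1 q.1.2.1 q.1.2.2 q.2.1 := by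
    have p := Primrec.fst.comp (Primrec.fst (α := (Code × ℕ × ℤ × ℕ × ℕ) × ℕ × ℕ)
      (β := List Bool × List Bool))
    have sm := Primrec.snd.comp (Primrec.fst (α := (Code × ℕ × ℤ × ℕ × ℕ) × ℕ × ℕ)
      (β := List Bool × List Bool))
    have w := Primrec.fst.comp (Primrec.snd (α := (Code × ℕ × ℤ × ℕ × ℕ) × ℕ × ℕ)
      (β := List Bool × List Bool))
    have p2 := Primrec.snd.comp p
    have p3 := Primrec.snd.comp p2
    have p4 := Primrec.snd.comp p3
    have h1 := (primrec_levelSum hD).comp (Primrec.pair (Primrec.fst.comp p)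
      (Primrec.pair (Primrec.fst.comp p2) (Primrec.pair (Primrec.fst.comp p3)
        (Primrec.pair (Primrec.fst.comp sm) (Primrec.pair (Primrec.snd.comp sm) w)))))
    exact Primrec.nat_lt.comp (Primrec.nat_mul.comp (Primrec.fst.comp p4)
      (primrec_nat_pow.comp (Primrec.const 2) (Primrec.snd.comp sm)))
      (Primrec.nat_mul.comp (Primrec.succ.comp (Primrec.snd.comp p4)) h1)
  have hg : Primrec fun q : (Code × ℕ × ℤ × ℕ × ℕ) × ℕ × ℕ => q.1.2.1 + q.2.1 :=
    Primrec.nat_add.comp (Primrec.fst.comp (Primrec.snd.comp Primrec.fst))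
      (Primrec.fst.comp Primrec.snd)
  refine (EffOpen.of_primrec hR hg).exists_param.of_iff ?_
  rintro ⟨c, n, k, a, b⟩ ω -
  simp only [levelSum_initSeg, Prod.exists, levelIntegral, lintegral_initSeg (κ ω) n
    (fun v => level c n (initSeg ω n) v k)]
  have hab : (a : ℝ≥0∞) / ((b : ℝ≥0∞) + 1) = ENNReal.ofReal ((a : ℝ) / (b + 1)) := by
    rw [ENNReal.ofReal_div_of_pos (by positivity), ENNReal.ofReal_add (by positivity) zero_le_one]
    simp
  rw [hab, ENNReal.ofReal_lt_ofReal_iff_of_nonneg (by positivity)]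
  exact lt_sum_iff_exists _ _ (U := fun s m v => U (initSeg ω s, v, m))
    (D := fun s m v => D (initSeg ω s, v, m)) (fun s m v => hκD ω s v m)
    (fun s m v => hκU ω s v m) (fun m v => hUD ω v m) a b

/-! ### Rational thresholds and measurability -/

theorem natCast_div_lt_div_iff (a b : ℕ) {N : ℕ} (hN : N ≠ 0) (y : ℝ≥0∞) :
    (a : ℝ≥0∞) / ((b : ℝ≥0∞) + 1) < y / N ↔
      ((a * N : ℕ) : ℝ≥0∞) / ((b : ℝ≥0∞) + 1) < y := by
  rw [ENNReal.lt_div_iff_mul_lt (Or.inl (by exact_mod_cast hN))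
    (Or.inl (ENNReal.natCast_ne_top N)), ENNReal.mul_comm_div, ← mul_div_assoc]
  push_cast
  rfl

theorem exists_natCast_div_btwn {x y : ℝ≥0∞} (h : x < y) :
    ∃ a b : ℕ, x < (a : ℝ≥0∞) / ((b : ℝ≥0∞) + 1) ∧ (a : ℝ≥0∞) / ((b : ℝ≥0∞) + 1) < y := by
  obtain ⟨q, hq, hxq, hqy⟩ := ENNReal.lt_iff_exists_rat_btwn.1 h
  have h1 : ((Real.toNNReal q : ℝ≥0) : ℝ≥0∞) =
      (q.num.toNat : ℝ≥0∞) / (((q.den - 1 : ℕ) : ℝ≥0∞) + 1) := by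
    have hd : ((q.den - 1 : ℕ) : ℝ≥0∞) + 1 = q.den := by
      have := q.den_pos
      have h2 : q.den - 1 + 1 = q.den := by omega
      exact_mod_cast h2
    rw [hd]
    change ENNReal.ofReal q = _
    have h3 : (q : ℝ) = (q.num.toNat : ℝ) / q.den := by
      have h4 : ((q.num.toNat : ℤ) : ℝ) = (q.num : ℝ) := by
        rw [Int.toNat_of_nonneg (Rat.num_nonneg.2 hq)]
      rw [Rat.cast_def, ← h4, Int.cast_natCast]
    rw [h3, ENNReal.ofReal_div_of_pos (by exact_mod_cast q.den_pos)]
    simp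
  exact ⟨_, _, h1 ▸ hxq, h1 ▸ hqy⟩

theorem LowerSemicomputable.measurable {X ι : Type} [Primcodable ι] [MeasurableSpace X]
    {B : ι → Set X} (hB : ∀ i, MeasurableSet (B i)) {f : X → ℝ≥0∞}
    (hf : LowerSemicomputable B f) : Measurable f := by
  obtain ⟨W, -, hW⟩ := hf
  have h1 : ∀ a b : ℕ, MeasurableSet {x | (a : ℝ≥0∞) / ((b : ℝ≥0∞) + 1) < f x} := by
    intro a b
    have : {x | (a : ℝ≥0∞) / ((b : ℝ≥0∞) + 1) < f x} = ⋃ i, ⋃ (_ : W (i, a, b)), B i := by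
      ext x; simp [hW]
    rw [this]
    exact MeasurableSet.iUnion fun i => MeasurableSet.iUnion fun _ => hB i
  refine measurable_of_Ioi fun x => ?_
  have : f ⁻¹' Set.Ioi x = ⋃ (a : ℕ) (b : ℕ) (_ : x < (a : ℝ≥0∞) / ((b : ℝ≥0∞) + 1)),
      {y | (a : ℝ≥0∞) / ((b : ℝ≥0∞) + 1) < f y} := by
    ext y
    simp only [Set.mem_preimage, Set.mem_Ioi, Set.mem_iUnion, Set.mem_ofPred_eq, exists_prop]
    exact ⟨exists_natCast_div_btwn, fun ⟨a, b, h, h'⟩ => h.trans h'⟩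
  rw [this]
  exact MeasurableSet.iUnion fun a => MeasurableSet.iUnion fun b => MeasurableSet.iUnion fun _ =>
    h1 a b

/-! ### Trimming and the maximal tests for one sequence -/

/-- The supremum of those levels whose integral is less than `L`. -/
noncomputable def trim (κ : Kernel Cantor Cantor) (c : Code) (L : ℕ) (ω ω' : Cantor) (k : ℤ) :
    ℝ≥0∞ :=
  ⨆ n, ⨆ (_ : levelIntegral κ c n ω k < L), (level c n (initSeg ω n) (initSeg ω' n) k : ℝ≥0∞)

theorem measurable_level (c : Code) (n : ℕ) (u : List Bool) (k : ℤ) :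
    Measurable fun ω' : Cantor => (level c n u (initSeg ω' n) k : ℝ≥0∞) :=
  measurable_initSeg_comp n fun v => (level c n u v k : ℝ≥0∞)

theorem measurable_trim (κ : Kernel Cantor Cantor) (c : Code) (L : ℕ) (ω : Cantor) (k : ℤ) :
    Measurable fun ω' => trim κ c L ω ω' k :=
  Measurable.iSup fun n => Measurable.iSup fun _ => measurable_level c n _ k

/-- The levels increase, so the admitted stages form a directed family, and monotone convergence
carries the bound to the supremum. -/
theorem lintegral_trim_le (κ : Kernel Cantor Cantor) (c : Code) (L : ℕ) (ω : Cantor) (k : ℤ) :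
    ∫⁻ ω', trim κ c L ω ω' k ∂(κ ω) ≤ L := by
  simp only [trim, iSup_subtype']
  rw [lintegral_iSup_directed]
  · exact iSup_le fun n => n.2.le
  · exact fun n => (measurable_level c n _ k).aemeasurable
  · intro m n
    rcases le_total m.1 n.1 with h | h
    · exact ⟨n, fun ω' => Nat.cast_le.2 (monotone_level c ω ω' k h), le_rfl⟩
    · exact ⟨m, le_rfl, fun ω' => Nat.cast_le.2 (monotone_level c ω ω' k h)⟩

theorem limLevel_le_trim {κ : Kernel Cantor Cantor} {c : Code} {L : ℕ} {ω : Cantor} {k : ℤ}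
    (h : ∫⁻ ω', limLevel c ω ω' k ∂(κ ω) < L) (ω' : Cantor) :
    limLevel c ω ω' k ≤ trim κ c L ω ω' k := by
  refine iSup_mono fun n => le_iSup_of_le ?_ le_rfl
  exact lt_of_le_of_lt (lintegral_mono fun ω' =>
    le_iSup (fun n => (level c n (initSeg ω n) (initSeg ω' n) k : ℝ≥0∞)) n) h

theorem lintegral_limLevel (κ : Kernel Cantor Cantor) (c : Code) (ω : Cantor) (k : ℤ) :
    ∫⁻ ω', limLevel c ω ω' k ∂(κ ω) = ⨆ n, levelIntegral κ c n ω k := by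
  simp only [limLevel, levelIntegral]
  exact lintegral_iSup (fun n => measurable_level c n _ k)
    fun m n h ω' => Nat.cast_le.2 (monotone_level c ω ω' k h)

theorem effOpen_lt_level :
    EffOpen fun (p : Code × ℕ × ℤ × ℕ × ℕ) ω ω' =>
      (p.2.2.2.1 : ℝ≥0∞) / ((p.2.2.2.2 : ℝ≥0∞) + 1) <
        (level p.1 p.2.1 (initSeg ω p.2.1) (initSeg ω' p.2.1) p.2.2.1 : ℝ≥0∞) := by
  have hR : PrimrecPred fun q : (Code × ℕ × ℤ × ℕ × ℕ) × List Bool × List Bool =>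
      q.1.2.2.2.1 < level q.1.1 q.1.2.1 q.2.1 q.2.2 q.1.2.2.1 * (q.1.2.2.2.2 + 1) := by
    have p := Primrec.fst (α := Code × ℕ × ℤ × ℕ × ℕ) (β := List Bool × List Bool)
    have uv := Primrec.snd (α := Code × ℕ × ℤ × ℕ × ℕ) (β := List Bool × List Bool)
    have p2 := Primrec.snd.comp p
    have p3 := Primrec.snd.comp p2
    have p4 := Primrec.snd.comp p3
    have h1 := primrec_level.comp (Primrec.pair (Primrec.fst.comp p)
      (Primrec.pair (Primrec.fst.comp p2) (Primrec.pair (Primrec.fst.comp uv)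
        (Primrec.pair (Primrec.snd.comp uv) (Primrec.fst.comp p3)))))
    exact Primrec.nat_lt.comp (Primrec.fst.comp p4)
      (Primrec.nat_mul.comp h1 (Primrec.succ.comp (Primrec.snd.comp p4)))
  refine (EffOpen.of_primrec hR (Primrec.fst.comp Primrec.snd)).of_iff ?_
  rintro ⟨c, n, k, a, b⟩ ω ω'
  dsimp only
  rw [ENNReal.div_lt_iff (Or.inl (by positivity)) (Or.inl (by finiteness))]
  norm_cast

theorem effOpen_lt_trim {κ : Kernel Cantor Cantor} [IsMarkovKernel κ]
    (hκ : IsUniformlyComputable κ) :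
    EffOpen fun (p : Code × ℕ × ℤ × ℕ × ℕ) ω ω' =>
      (p.2.2.2.1 : ℝ≥0∞) / ((p.2.2.2.2 : ℝ≥0∞) + 1) < trim κ p.1 p.2.1 ω ω' p.2.2.1 := by
  have p := Primrec.fst (α := Code × ℕ × ℤ × ℕ × ℕ) (β := ℕ)
  have n := Primrec.snd (α := Code × ℕ × ℤ × ℕ × ℕ) (β := ℕ)
  have c := Primrec.fst.comp p
  have L := Primrec.fst.comp (Primrec.snd.comp p)
  have k := Primrec.fst.comp (Primrec.snd.comp (Primrec.snd.comp p))
  have q := Primrec.snd.comp (Primrec.snd.comp p)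
  have h1 := (effOpen_levelIntegral_lt hκ).comp
    (Primrec.pair c (Primrec.pair n (Primrec.pair k L)))
  have h2 := effOpen_lt_level.comp (Primrec.pair c (Primrec.pair n q))
  refine (h1.and h2).exists_param.of_iff ?_
  rintro ⟨c, L, k, a, b⟩ ω ω'
  simp only [trim, lt_iSup_iff, exists_prop]

theorem tsum_inv_two_pow_encode_le : ∑' c : Code, ((2 : ℝ≥0∞) ^ encode c)⁻¹ ≤ 2 := by
  simpa only [ENNReal.inv_pow] using ENNReal.tsum_geometric_two_encode_le_two (ι := Code)

theorem effOpen_of_lowerSemicomputable_cond {f : Cantor × Cantor × ℤ → ℝ≥0∞}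
    (hf : LowerSemicomputable cylCond f) :
    EffOpen fun (p : ℕ × ℤ) ω ω' => (p.1 : ℝ≥0∞) < f (ω', ω, p.2) := by
  refine ((lowerSemicomputable_cond_iff.1 hf).comp (f := fun p : ℕ × ℤ => (p.1, 0, p.2))
    (Primrec.pair Primrec.fst (Primrec.pair (Primrec.const 0) Primrec.snd))).of_iff ?_
  simp

/-- Every lower semicomputable function agrees, up to an additive error of at most one, with the
limit of the levels of some code. -/
theorem LowerSemicomputable.exists_code {f : Cantor × Cantor × ℤ → ℝ≥0∞}
    (hf : LowerSemicomputable cylCond f) :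
    ∃ c : Code, ∀ ω ω' k, f (ω', ω, k) ≤ limLevel c ω ω' k ∧
      limLevel c ω ω' k ≤ f (ω', ω, k) + 1 := by
  obtain ⟨c, hc⟩ := (effOpen_of_lowerSemicomputable_cond hf).exists_represents
  exact ⟨c, fun ω ω' k => ⟨hc.le_limLevel fun a => Iff.rfl, hc.limLevel_le fun a => Iff.rfl⟩⟩

theorem isCondTest_trim {κ : Kernel Cantor Cantor} [IsMarkovKernel κ]
    (hκ : IsUniformlyComputable κ) (c : Code) {L : ℤ → ℕ} (hL : Primrec L) (hL0 : ∀ k, L k ≠ 0) :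
    IsCondTest κ fun x => trim κ c (L x.2.2) x.2.1 x.1 x.2.2 / L x.2.2 := by
  constructor
  · rw [lowerSemicomputable_cond_iff]
    have a := Primrec.fst (α := ℕ) (β := ℕ × ℤ)
    have b := Primrec.fst.comp (Primrec.snd (α := ℕ) (β := ℕ × ℤ))
    have k := Primrec.snd.comp (Primrec.snd (α := ℕ) (β := ℕ × ℤ))
    have L' := hL.comp k
    refine ((effOpen_lt_trim hκ).comp (Primrec.pair (Primrec.const c) (Primrec.pair L'
      (Primrec.pair k (Primrec.pair (Primrec.nat_mul.comp a L') b))))).of_iff fun p ω ω' => ?_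
    exact natCast_div_lt_div_iff _ _ (hL0 _) _
  · intro ω k
    have h0 : (L k : ℝ≥0∞) ≠ 0 := by exact_mod_cast hL0 k
    simp only [div_eq_mul_inv]
    rw [lintegral_mul_const _ (measurable_trim κ c (L k) ω k), ← div_eq_mul_inv]
    exact ENNReal.div_le_of_le_mul (by simpa using lintegral_trim_le κ c (L k) ω k)

theorem exists_isMaximalCondTest {κ : Kernel Cantor Cantor} [IsMarkovKernel κ]
    (hκ : IsUniformlyComputable κ) : ∃ t, IsMaximalCondTest κ t := by
  -- The bound 3 strictly exceeds `1 + 1`, the integral of a test plus the additive error. The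
  -- weights `1 / (6 * 2 ^ encode c)` have sum at most `1 / 3`. A supremum is used because exceeding
  -- a threshold then just means that some `c` exceeds it.
  refine ⟨fun x => ⨆ c : Code, trim κ c 3 x.2.1 x.1 x.2.2 / ((6 * 2 ^ encode c : ℕ) : ℝ≥0∞),
    ⟨?_, ?_⟩, ?_⟩
  · rw [lowerSemicomputable_cond_iff]
    have c := Primrec.snd (α := ℕ × ℕ × ℤ) (β := Code)
    have p := Primrec.fst (α := ℕ × ℕ × ℤ) (β := Code)
    have a := Primrec.fst.comp p
    have b := Primrec.fst.comp (Primrec.snd.comp p)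
    have k := Primrec.snd.comp (Primrec.snd.comp p)
    have N := Primrec.nat_mul.comp (Primrec.const 6)
      (primrec_nat_pow.comp (Primrec.const 2) (Primrec.encode.comp c))
    refine ((effOpen_lt_trim hκ).comp (Primrec.pair c (Primrec.pair (Primrec.const 3)
      (Primrec.pair k (Primrec.pair (Primrec.nat_mul.comp a N) b))))).exists_param.of_iff
        fun p ω ω' => ?_
    simp only [lt_iSup_iff]
    exact exists_congr fun c => natCast_div_lt_div_iff _ _ (by positivity) _
  · intro ω k
    calc ∫⁻ ω', ⨆ c : Code, trim κ c 3 ω ω' k / ((6 * 2 ^ encode c : ℕ) : ℝ≥0∞) ∂(κ ω)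
        ≤ ∫⁻ ω', ∑' c : Code, trim κ c 3 ω ω' k / ((6 * 2 ^ encode c : ℕ) : ℝ≥0∞) ∂(κ ω) :=
          lintegral_mono fun ω' => iSup_le fun c => ENNReal.le_tsum c
      _ = ∑' c : Code, (∫⁻ ω', trim κ c 3 ω ω' k ∂(κ ω)) / ((6 * 2 ^ encode c : ℕ) : ℝ≥0∞) := by
          simp only [div_eq_mul_inv]
          rw [lintegral_tsum fun c => ((measurable_trim κ c 3 ω k).mul_const _).aemeasurable]
          exact tsum_congr fun c => lintegral_mul_const _ (measurable_trim κ c 3 ω k)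
      _ ≤ ∑' c : Code, 3 / 6 * ((2 : ℝ≥0∞) ^ encode c)⁻¹ := by
          refine ENNReal.tsum_le_tsum fun c => ?_
          rw [div_eq_mul_inv, div_eq_mul_inv, mul_assoc]
          refine mul_le_mul' (lintegral_trim_le κ c 3 ω k) ?_
          push_cast
          rw [ENNReal.mul_inv (by simp) (by simp)]
      _ ≤ 3 / 6 * 2 := by
          rw [ENNReal.tsum_mul_left]
          gcongr
          exact tsum_inv_two_pow_encode_le
      _ ≤ 1 := by
          rw [← ENNReal.mul_div_right_comm]
          exact ENNReal.div_le_of_le_mul (by norm_num)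
  · intro s hs
    obtain ⟨c, hc⟩ := hs.lowerSemicomputable.exists_code
    refine ⟨6 * 2 ^ encode c, ?_⟩
    rintro ⟨ω', ω, k⟩
    have hlt : ∫⁻ ω', limLevel c ω ω' k ∂(κ ω) < (3 : ℕ) := by
      calc ∫⁻ ω', limLevel c ω ω' k ∂(κ ω) ≤ ∫⁻ ω', (s (ω', ω, k) + 1) ∂(κ ω) :=
            lintegral_mono fun ω' => (hc ω ω' k).2
        _ = ∫⁻ ω', s (ω', ω, k) ∂(κ ω) + 1 := by
            rw [lintegral_add_right _ measurable_const]; simp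
        _ ≤ 1 + 1 := by gcongr; exact hs.lintegral_le_one ω k
        _ < (3 : ℕ) := by norm_num
    have h1 := (hc ω ω' k).1.trans (limLevel_le_trim hlt ω')
    have h2 := le_iSup (fun c : Code => trim κ c 3 ω ω' k / ((6 * 2 ^ encode c : ℕ) : ℝ≥0∞)) c
    rw [ENNReal.div_le_iff (by positivity) (by finiteness)] at h2
    refine h1.trans (h2.trans_eq ?_)
    rw [mul_comm]
    push_cast
    rfl

theorem IsComputableMeasure.isUniformlyComputable_const {μ : Measure Cantor}
    (hμ : IsComputableMeasure μ) : IsUniformlyComputable (Kernel.const Cantor μ) := by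
  obtain ⟨A, hA, h⟩ := hμ
  refine ⟨fun _ x => some (A x.1 x.2), ?_, fun ω v n => ⟨⟨0, _, rfl⟩, ?_⟩⟩
  · exact Computable.option_some.comp (hA.comp (Computable.fst.comp Computable.snd)
      (Computable.snd.comp Computable.snd))
  · rintro s a ⟨rfl⟩
    simpa using h v n

/-- For a constant kernel, a test of one sequence is a conditional test that ignores the condition;
conversely, the condition is fixed at the zero sequence and `k = 0`. -/
theorem exists_isMaximalTest {μ : Measure Cantor} [IsProbabilityMeasure μ]
    (hμ : IsComputableMeasure μ) : ∃ t, IsMaximalTest cyl μ t := by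
  obtain ⟨t, ht, hmax⟩ := exists_isMaximalCondTest hμ.isUniformlyComputable_const
  refine ⟨fun ω => t (ω, fun _ => false, 0), ⟨?_, ?_⟩, ?_⟩
  · rw [lowerSemicomputable_iff]
    exact (lowerSemicomputable_cond_iff.1 ht.lowerSemicomputable).zero_left.swap.comp
      (f := fun p : ℕ × ℕ => (p.1, p.2, (0 : ℤ)))
      (Primrec.pair Primrec.fst (Primrec.pair Primrec.snd (Primrec.const 0)))
  · simpa using ht.lintegral_le_one (fun _ => false) 0
  · intro s hs
    have hs' : IsCondTest (Kernel.const Cantor μ) fun x => s x.1 := by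
      constructor
      · rw [lowerSemicomputable_cond_iff]
        exact (lowerSemicomputable_iff.1 hs.lowerSemicomputable).swap.comp
          (f := fun p : ℕ × ℕ × ℤ => (p.1, p.2.1))
          (Primrec.pair Primrec.fst (Primrec.fst.comp Primrec.snd))
      · intro ω k
        simpa using hs.lintegral_le_one
    obtain ⟨C, hC⟩ := hmax _ hs'
    exact ⟨C, fun ω => hC (ω, fun _ => false, 0)⟩

/-! ### Integer powers of two and lower bounds for maximal tests -/

theorem primrec_toNat : Primrec Int.toNat := by
  refine Primrec.ofNat_iff.2 ((Primrec.ite (Primrec.eq.comp (Primrec.nat_mod.comp Primrec.id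
    (Primrec.const 2)) (Primrec.const 0)) (Primrec.nat_div.comp Primrec.id (Primrec.const 2))
    (Primrec.const 0)).of_eq fun n => ?_)
  obtain ⟨z, rfl⟩ : ∃ z : ℤ, encode z = n := ⟨Denumerable.ofNat ℤ n, Denumerable.encode_ofNat n⟩
  rw [Denumerable.ofNat_encode]
  rcases z with k | k
  · have : encode (k : ℤ) = 2 * k := rfl
    simp [this]
  · have : encode (Int.negSucc k) = 2 * k + 1 := rfl
    simp [this]

theorem primrec_neg_toNat : Primrec fun k : ℤ => (-k).toNat := by
  refine Primrec.ofNat_iff.2 ((Primrec.ite (Primrec.eq.comp (Primrec.nat_mod.comp Primrec.id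
    (Primrec.const 2)) (Primrec.const 0)) (Primrec.const 0)
    (Primrec.succ.comp (Primrec.nat_div.comp Primrec.id (Primrec.const 2)))).of_eq fun n => ?_)
  obtain ⟨z, rfl⟩ : ∃ z : ℤ, encode z = n := ⟨Denumerable.ofNat ℤ n, Denumerable.encode_ofNat n⟩
  rw [Denumerable.ofNat_encode]
  rcases z with k | k
  · have : encode (k : ℤ) = 2 * k := rfl
    simp [this]
  · have : encode (Int.negSucc k) = 2 * k + 1 := rfl
    simp [this, Int.neg_negSucc]
    omega

theorem two_zpow_eq (k : ℤ) :
    (2 : ℝ≥0∞) ^ k = ((2 ^ k.toNat : ℕ) : ℝ≥0∞) / ((2 ^ (-k).toNat : ℕ) : ℝ≥0∞) := by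
  rcases k with k | k
  · simp
  · simp [zpow_negSucc, Int.neg_negSucc]

/-- With `2 ^ n < x ≤ 2 ^ (n + 1)`, the nonzero terms have exponents `n, n - 1, …`, and their
geometric sum is `2 * 2 ^ n`. -/
theorem tsum_two_zpow_lt_le (x : ℝ≥0∞) :
    ∑' k : ℤ, (⨆ (_ : (2 : ℝ≥0∞) ^ k < x), (2 : ℝ≥0∞) ^ k) ≤ 2 * x := by
  rcases eq_or_ne x ⊤ with rfl | hx
  · simp
  rcases eq_or_ne x 0 with rfl | hx0
  · simp
  obtain ⟨n, hn, hn'⟩ := ENNReal.exists_mem_Ioc_zpow hx0 hx ENNReal.one_lt_two (by simp)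
  have hinj : Function.Injective fun i : ℕ => n - (i : ℤ) := fun i j h => by
    simpa using h
  rw [← hinj.tsum_eq]
  · calc ∑' i : ℕ, (⨆ (_ : (2 : ℝ≥0∞) ^ (n - (i : ℤ)) < x), (2 : ℝ≥0∞) ^ (n - (i : ℤ)))
        ≤ ∑' i : ℕ, 2 ^ n * (2⁻¹ : ℝ≥0∞) ^ i := by
          refine ENNReal.tsum_le_tsum fun i => iSup_le fun _ => le_of_eq ?_
          rw [ENNReal.zpow_sub (by simp) (by simp)]
          simp [ENNReal.inv_pow]
      _ = 2 ^ n * 2 := by rw [ENNReal.tsum_mul_left, ENNReal.tsum_geometric_two]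
      _ ≤ 2 * x := by
          rw [mul_comm]
          gcongr
  · intro k hk
    by_contra hr
    refine hk ?_
    have : ¬ (2 : ℝ≥0∞) ^ k < x := by
      intro hlt
      have h1 : k < n + 1 := by
        by_contra! hge
        exact absurd (hlt.trans_le hn') (not_lt.2 (ENNReal.zpow_le_of_le one_le_two hge))
      exact hr ⟨(n - k).toNat, by simp; omega⟩
    simp [this]

theorem exists_le_two_pow (C : ℝ≥0) : ∃ n : ℕ, (C : ℝ≥0∞) ≤ 2 ^ n := by
  obtain ⟨n, hn⟩ := pow_unbounded_of_one_lt C one_lt_two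
  exact ⟨n, by exact_mod_cast hn.le⟩

theorem effOpen_lt_one :
    EffOpen fun (p : ℕ × ℕ) (_ _ : Cantor) => (p.1 : ℝ≥0∞) / ((p.2 : ℝ≥0∞) + 1) < 1 := by
  refine (EffOpen.of_primrecPred (R := fun p : ℕ × ℕ => p.1 < p.2 + 1)
    (Primrec.nat_lt.comp Primrec.fst (Primrec.succ.comp Primrec.snd))).of_iff fun p _ _ => ?_
  rw [ENNReal.div_lt_iff (Or.inl (by positivity)) (Or.inl (by finiteness)), one_mul]
  norm_cast

/-- The constant 1 is a test. -/
theorem IsMaximalTest.exists_one_le {μ : Measure Cantor} [IsProbabilityMeasure μ]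
    {t : Cantor → ℝ≥0∞} (ht : IsMaximalTest cyl μ t) : ∃ n : ℕ, ∀ ω, 1 ≤ 2 ^ n * t ω := by
  obtain ⟨C, hC⟩ := ht.maximal (fun _ => 1) ⟨lowerSemicomputable_iff.2 effOpen_lt_one, by simp⟩
  obtain ⟨n, hn⟩ := exists_le_two_pow C
  exact ⟨n, fun ω => (hC ω).trans (mul_le_mul_left hn _)⟩

theorem IsMaximalCondTest.exists_one_le {κ : Kernel Cantor Cantor} [IsMarkovKernel κ]
    {t : Cantor × Cantor × ℤ → ℝ≥0∞} (ht : IsMaximalCondTest κ t) :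
    ∃ n : ℕ, ∀ x, 1 ≤ 2 ^ n * t x := by
  obtain ⟨C, hC⟩ := ht.maximal (fun _ => 1) ⟨lowerSemicomputable_cond_iff.2
    (effOpen_lt_one.comp (f := fun p : ℕ × ℕ × ℤ => (p.1, p.2.1))
      (Primrec.pair Primrec.fst (Primrec.fst.comp Primrec.snd))), by simp⟩
  obtain ⟨n, hn⟩ := exists_le_two_pow C
  exact ⟨n, fun ω => (hC ω).trans (mul_le_mul_left hn _)⟩

/-- The numbers `x` and `2 ^ k` agree up to the factor `2 ^ R`, unless `x` is infinite. -/
def Near (R : ℕ) (k : ℤ) (x : ℝ≥0∞) : Prop :=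
  x ≠ ⊤ → x ≤ 2 ^ R * 2 ^ k ∧ (2 : ℝ≥0∞) ^ k ≤ 2 ^ R * x

theorem exists_near {x : ℝ≥0∞} (hx : x ≠ 0) : ∃ k, Near 1 k x := by
  rcases eq_or_ne x ⊤ with rfl | hx'
  · exact ⟨0, fun h => absurd rfl h⟩
  obtain ⟨n, hn, hn'⟩ := ENNReal.exists_mem_Ioc_zpow hx hx' ENNReal.one_lt_two (by simp)
  refine ⟨n, fun _ => ⟨?_, ?_⟩⟩
  · rw [pow_one]
    rwa [ENNReal.zpow_add (by simp) (by simp), zpow_one, mul_comm] at hn'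
  · exact hn.le.trans (le_mul_of_one_le_left' (by simp))

/-! ### The two inequalities for the pair -/

section Pair

variable {P₁ : Measure Cantor} [IsProbabilityMeasure P₁] {κ : Kernel Cantor Cantor}
  [IsMarkovKernel κ]

theorem LowerSemicomputable.measurable_pair {f : Cantor × Cantor → ℝ≥0∞}
    (hf : LowerSemicomputable cylPair f) : Measurable f :=
  LowerSemicomputable.measurable (B := cylPair)
    (fun p => (measurableSet_cyl p.1).prod (measurableSet_cyl p.2)) hf

theorem LowerSemicomputable.measurable_cond {f : Cantor × Cantor × ℤ → ℝ≥0∞}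
    (hf : LowerSemicomputable cylCond f) : Measurable f :=
  LowerSemicomputable.measurable (B := cylCond) (fun p => (measurableSet_cyl p.1).prod
    ((measurableSet_cyl p.2.1).prod (measurableSet_singleton _))) hf

theorem LowerSemicomputable.comp_swap {s : Cantor × Cantor → ℝ≥0∞}
    (hs : LowerSemicomputable cylPair s) :
    LowerSemicomputable cylCond fun x => s (x.2.1, x.1) := by
  rw [lowerSemicomputable_cond_iff]
  exact (lowerSemicomputable_pair_iff.1 hs).comp (f := fun p : ℕ × ℕ × ℤ => (p.1, p.2.1))
    (Primrec.pair Primrec.fst (Primrec.fst.comp Primrec.snd))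

theorem lowerSemicomputable_lintegral_limLevel (hκ : IsUniformlyComputable κ) (c : Code) {N : ℕ}
    (hN : N ≠ 0) :
    LowerSemicomputable cyl fun ω => (∫⁻ ω', limLevel c ω ω' 0 ∂(κ ω)) / N := by
  rw [lowerSemicomputable_iff]
  have a := Primrec.fst.comp (Primrec.fst (α := ℕ × ℕ) (β := ℕ))
  have b := Primrec.snd.comp (Primrec.fst (α := ℕ × ℕ) (β := ℕ))
  refine ((effOpen_lt_levelIntegral hκ).comp (Primrec.pair (Primrec.const c)
    (Primrec.pair Primrec.snd (Primrec.pair (Primrec.const 0) (Primrec.pair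
      (Primrec.nat_mul.comp a (Primrec.const N)) b))))).exists_param.of_iff fun p ω _ => ?_
  rw [natCast_div_lt_div_iff _ _ hN, lintegral_limLevel, lt_iSup_iff]

theorem lintegral_add_one (μ : Measure Cantor) [IsProbabilityMeasure μ] (f : Cantor → ℝ≥0∞) :
    ∫⁻ ω, (f ω + 1) ∂μ = ∫⁻ ω, f ω ∂μ + 1 := by
  rw [lintegral_add_right _ measurable_const]; simp

/-- A test for the pair is bounded by the product of the maximal test for the first component and
the maximal conditional test for the second one. -/
theorem IsTest.exists_le_mul (hκ : IsUniformlyComputable κ) {t₁ : Cantor → ℝ≥0∞}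
    {t₂ : Cantor × Cantor × ℤ → ℝ≥0∞} (ht₁ : IsMaximalTest cyl P₁ t₁)
    (ht₂ : IsMaximalCondTest κ t₂) {s : Cantor × Cantor → ℝ≥0∞}
    (hs : IsTest cylPair (P₁.compProd κ) s) (R : ℕ) :
    ∃ n : ℕ, ∀ ω ω' k, Near R k (t₁ ω) → s (ω, ω') ≤ 2 ^ n * (t₁ ω * t₂ (ω', ω, k)) := by
  obtain ⟨c, hc⟩ := hs.lowerSemicomputable.comp_swap.exists_code
  dsimp only at hc
  -- The code `c` may approximate `s` differently for different `k`, although `s` ignores `k`.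
  -- Fixing `k = 0` gives a function of `ω` alone; other values of `k` cost at most an additive one.
  set F : Cantor → ℝ≥0∞ := fun ω => ∫⁻ ω', limLevel c ω ω' 0 ∂(κ ω) with hF
  have hs_int := hs.lintegral_le_one
  rw [Measure.lintegral_compProd hs.lowerSemicomputable.measurable_pair] at hs_int
  have hFtest : IsTest cyl P₁ fun ω => F ω / (2 : ℕ) := by
    refine ⟨lowerSemicomputable_lintegral_limLevel hκ c two_ne_zero, ?_⟩
    simp only [div_eq_mul_inv]
    rw [lintegral_mul_const' _ _ (by simp), ← div_eq_mul_inv]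
    refine ENNReal.div_le_of_le_mul ?_
    calc ∫⁻ ω, F ω ∂P₁ ≤ ∫⁻ ω, (∫⁻ ω', s (ω, ω') ∂(κ ω) + 1) ∂P₁ := by
          refine lintegral_mono fun ω => ?_
          rw [← lintegral_add_one]
          exact lintegral_mono fun ω' => (hc ω ω' 0).2
      _ ≤ 1 + 1 := by rw [lintegral_add_one]; gcongr
      _ = 1 * (2 : ℕ) := by norm_num
  obtain ⟨C, hC⟩ := ht₁.maximal _ hFtest
  obtain ⟨A, hA⟩ := exists_le_two_pow C
  have hFA : ∀ ω, F ω ≤ 2 ^ (A + 1) * t₁ ω := by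
    intro ω
    have := (hC ω).trans (mul_le_mul_left hA _)
    rw [ENNReal.div_le_iff (by simp) (by simp)] at this
    refine this.trans_eq ?_
    push_cast
    ring
  obtain ⟨D, hD⟩ := ht₁.exists_one_le
  obtain ⟨E, hE⟩ := ht₂.exists_one_le
  -- The trimming bound must be a natural number, hence `k.toNat`. Replacing a negative `k` by 0
  -- costs only a constant factor, since `t₁` is bounded away from 0. In the exponent, `A + R` comes
  -- from `F ≤ 2 ^ (A + 1) * t₁` and the rounding; the 3 covers the factor 2 there, the additive one
  -- and strictness.
  have hL : Primrec fun k : ℤ => 2 ^ (k.toNat + (A + R + 3)) :=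
    primrec_nat_pow.comp (Primrec.const 2)
      (Primrec.nat_add.comp primrec_toNat (Primrec.const _))
  obtain ⟨C', hC'⟩ := ht₂.maximal _ (isCondTest_trim hκ c hL fun k => by positivity)
  obtain ⟨B, hB⟩ := exists_le_two_pow C'
  refine ⟨A + R + 3 + B + R + D, fun ω ω' k hk => ?_⟩
  rcases eq_or_ne (t₁ ω) ⊤ with htop | htop
  · have : t₂ (ω', ω, k) ≠ 0 := fun h0 => by simpa [h0] using hE (ω', ω, k)
    rw [htop, ENNReal.top_mul this, ENNReal.mul_top (by positivity)]
    exact le_top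
  obtain ⟨hk1, hk2⟩ := hk htop
  have hpow : (2 : ℝ≥0∞) ^ k ≤ 2 ^ k.toNat := by
    rw [← zpow_natCast]
    exact ENNReal.zpow_le_of_le one_le_two (Int.self_le_toNat k)
  have hlt : ∫⁻ ω', limLevel c ω ω' k ∂(κ ω) < ((2 ^ (k.toNat + (A + R + 3)) : ℕ) : ℝ≥0∞) := by
    calc ∫⁻ ω', limLevel c ω ω' k ∂(κ ω) ≤ ∫⁻ ω', (limLevel c ω ω' 0 + 1) ∂(κ ω) :=
          lintegral_mono fun ω' => (hc ω ω' k).2.trans (by gcongr; exact (hc ω ω' 0).1)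
      _ = F ω + 1 := lintegral_add_one _ _
      _ ≤ 2 ^ (A + 1) * (2 ^ R * 2 ^ k.toNat) + 2 ^ (A + 1) * (2 ^ R * 2 ^ k.toNat) := by
          gcongr
          · exact (hFA ω).trans (by gcongr; exact hk1.trans (by gcongr))
          · exact_mod_cast Nat.one_le_iff_ne_zero.2 (by positivity)
      _ < ((2 ^ (k.toNat + (A + R + 3)) : ℕ) : ℝ≥0∞) := by
          norm_cast
          have : 0 < 2 ^ A * 2 ^ R * 2 ^ k.toNat := by positivity
          rw [pow_add, pow_add, pow_add, pow_add]
          nlinarith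
  have hpow2 : (2 : ℝ≥0∞) ^ k.toNat ≤ 2 ^ (R + D) * t₁ ω := by
    rcases le_total 0 k with h0 | h0
    · rw [← zpow_natCast, Int.toNat_of_nonneg h0]
      refine hk2.trans ?_
      gcongr
      · exact one_le_two
      · omega
    · rw [Int.toNat_of_nonpos h0, pow_zero]
      refine (hD ω).trans ?_
      gcongr
      · exact one_le_two
      · omega
  have h1 := hC' (ω', ω, k)
  dsimp only at h1
  rw [ENNReal.div_le_iff (by positivity) (by finiteness)] at h1
  calc s (ω, ω') ≤ limLevel c ω ω' k := (hc ω ω' k).1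
    _ ≤ trim κ c (2 ^ (k.toNat + (A + R + 3))) ω ω' k := limLevel_le_trim hlt ω'
    _ ≤ 2 ^ B * t₂ (ω', ω, k) * ((2 ^ (k.toNat + (A + R + 3)) : ℕ) : ℝ≥0∞) :=
        h1.trans (by gcongr)
    _ = 2 ^ (A + R + 3 + B) * t₂ (ω', ω, k) * 2 ^ k.toNat := by push_cast; ring
    _ ≤ 2 ^ (A + R + 3 + B) * t₂ (ω', ω, k) * (2 ^ (R + D) * t₁ ω) := by gcongr
    _ = _ := by ring

/-- The test for the pair obtained from a test for the first component and a conditional test, with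
all the lower bounds of the first one, up to the factor `2 ^ j`, put in the condition. -/
noncomputable def prodTest (t₁ : Cantor → ℝ≥0∞) (t₂ : Cantor × Cantor × ℤ → ℝ≥0∞) (j : ℕ)
    (x : Cantor × Cantor) : ℝ≥0∞ :=
  (⨆ k : ℤ, ⨆ (_ : (2 : ℝ≥0∞) ^ k < 2 ^ j * t₁ x.1), 2 ^ k * t₂ (x.2, x.1, k)) /
    ((2 ^ (j + 1) : ℕ) : ℝ≥0∞)

theorem lowerSemicomputable_prodTest {t₁ : Cantor → ℝ≥0∞} {t₂ : Cantor × Cantor × ℤ → ℝ≥0∞}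
    (h₁ : LowerSemicomputable cyl t₁) (h₂ : LowerSemicomputable cylCond t₂) (j : ℕ) :
    LowerSemicomputable cylPair (prodTest t₁ t₂ j) := by
  rw [lowerSemicomputable_pair_iff]
  have k := Primrec.snd (α := ℕ × ℕ) (β := ℤ)
  have a := Primrec.fst.comp (Primrec.fst (α := ℕ × ℕ) (β := ℤ))
  have b := Primrec.snd.comp (Primrec.fst (α := ℕ × ℕ) (β := ℤ))
  have pow : ∀ {f : (ℕ × ℕ) × ℤ → ℕ}, Primrec f → Primrec fun x => 2 ^ f x :=
    fun hf => primrec_nat_pow.comp (Primrec.const 2) hf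
  have kp := pow (primrec_toNat.comp k)
  have km := pow (primrec_neg_toNat.comp k)
  -- With `2 ^ k` written as a fraction, both conditions become rational thresholds for `t₁` and
  -- `t₂`. The predecessors appear because denominators have the form `b + 1`.
  have e1 := (lowerSemicomputable_iff.1 h₁).comp (Primrec.pair kp (Primrec.pred.comp
    (Primrec.nat_mul.comp km (Primrec.const (2 ^ j)))))
  have e2 := (lowerSemicomputable_cond_iff.1 h₂).comp (Primrec.pair
    (Primrec.nat_mul.comp (Primrec.nat_mul.comp a (Primrec.const (2 ^ (j + 1)))) km)
    (Primrec.pair (Primrec.pred.comp (Primrec.nat_mul.comp (Primrec.succ.comp b) kp)) k))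
  refine (e1.and e2).exists_param.of_iff fun p ω ω' => ?_
  rw [prodTest, natCast_div_lt_div_iff _ _ (by positivity)]
  simp only [lt_iSup_iff, exists_prop]
  have cast_pred : ∀ n : ℕ, n ≠ 0 → ((n.pred : ℕ) : ℝ≥0∞) + 1 = n := by
    intro n hn
    exact_mod_cast Nat.succ_pred hn
  refine exists_congr fun k => and_congr ?_ ?_
  · rw [cast_pred _ (by positivity), two_zpow_eq,
      ENNReal.div_lt_iff (Or.inl (by positivity)) (Or.inl (by finiteness)),
      ENNReal.div_lt_iff (Or.inl (by positivity)) (Or.inl (by finiteness))]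
    push_cast
    rw [mul_comm ((2 : ℝ≥0∞) ^ j), mul_assoc, mul_comm ((2 : ℝ≥0∞) ^ j)]
  · rw [cast_pred _ (by positivity), two_zpow_eq,
      ENNReal.div_lt_iff (Or.inl (by positivity)) (Or.inl (by finiteness)),
      ENNReal.div_lt_iff (Or.inl (by positivity)) (Or.inl (by finiteness)),
      ← ENNReal.mul_div_right_comm, ← ENNReal.mul_div_right_comm,
      ENNReal.lt_div_iff_mul_lt (Or.inl (by positivity)) (Or.inl (by finiteness))]
    push_cast
    rw [mul_comm ((2 : ℝ≥0∞) ^ k.toNat), mul_assoc (t₂ _), mul_comm ((2 : ℝ≥0∞) ^ k.toNat)]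

theorem isTest_prodTest {t₁ : Cantor → ℝ≥0∞} {t₂ : Cantor × Cantor × ℤ → ℝ≥0∞}
    (h₁ : IsTest cyl P₁ t₁) (h₂ : IsCondTest κ t₂) (j : ℕ) :
    IsTest cylPair (P₁.compProd κ) (prodTest t₁ t₂ j) := by
  have hlsc := lowerSemicomputable_prodTest h₁.lowerSemicomputable h₂.lowerSemicomputable j
  refine ⟨hlsc, ?_⟩
  rw [Measure.lintegral_compProd hlsc.measurable_pair]
  refine (lintegral_mono fun ω => ?_).trans h₁.lintegral_le_one
  have hm : ∀ k : ℤ, Measurable fun ω' => t₂ (ω', ω, k) := fun k =>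
    h₂.lowerSemicomputable.measurable_cond.comp (by fun_prop)
  have hm' : ∀ k : ℤ, Measurable fun ω' =>
      ⨆ (_ : (2 : ℝ≥0∞) ^ k < 2 ^ j * t₁ ω), 2 ^ k * t₂ (ω', ω, k) := fun k =>
    Measurable.iSup fun _ => (hm k).const_mul _
  simp only [prodTest, div_eq_mul_inv]
  rw [lintegral_mul_const _ (Measurable.iSup hm'), ← div_eq_mul_inv]
  refine ENNReal.div_le_of_le_mul ?_
  calc ∫⁻ ω', ⨆ k : ℤ, ⨆ (_ : (2 : ℝ≥0∞) ^ k < 2 ^ j * t₁ ω), 2 ^ k * t₂ (ω', ω, k) ∂(κ ω)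
      ≤ ∫⁻ ω', ∑' k : ℤ, ⨆ (_ : (2 : ℝ≥0∞) ^ k < 2 ^ j * t₁ ω), 2 ^ k * t₂ (ω', ω, k) ∂(κ ω) :=
        lintegral_mono fun ω' => iSup_le fun k => ENNReal.le_tsum (f := fun k : ℤ =>
          ⨆ (_ : (2 : ℝ≥0∞) ^ k < 2 ^ j * t₁ ω), 2 ^ k * t₂ (ω', ω, k)) k
    _ = ∑' k : ℤ, ∫⁻ ω', ⨆ (_ : (2 : ℝ≥0∞) ^ k < 2 ^ j * t₁ ω), 2 ^ k * t₂ (ω', ω, k) ∂(κ ω) :=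
        lintegral_tsum fun k => (hm' k).aemeasurable
    _ ≤ ∑' k : ℤ, ⨆ (_ : (2 : ℝ≥0∞) ^ k < 2 ^ j * t₁ ω), (2 : ℝ≥0∞) ^ k := by
        refine ENNReal.tsum_le_tsum fun k => ?_
        by_cases hk : (2 : ℝ≥0∞) ^ k < 2 ^ j * t₁ ω
        · simp only [hk, iSup_pos]
          rw [lintegral_const_mul _ (hm k)]
          exact mul_le_of_le_one_right' (h₂.lintegral_le_one ω k)
        · simp [hk]
    _ ≤ 2 * (2 ^ j * t₁ ω) := tsum_two_zpow_lt_le _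
    _ = t₁ ω * ((2 ^ (j + 1) : ℕ) : ℝ≥0∞) := by push_cast; ring

/-- If `t₁ ω` is infinite, every `k` is admitted, and `2 ^ k * t₂` is unbounded because `t₂` is
bounded away from 0. -/
theorem prodTest_eq_top {t₁ : Cantor → ℝ≥0∞} {t₂ : Cantor × Cantor × ℤ → ℝ≥0∞} {E : ℕ}
    (hE : ∀ x, 1 ≤ 2 ^ E * t₂ x) (j : ℕ) {ω : Cantor} (hω : t₁ ω = ⊤) (ω' : Cantor) :
    prodTest t₁ t₂ j (ω, ω') = ⊤ := by
  rw [prodTest, ENNReal.div_eq_top]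
  refine Or.inr ⟨?_, by finiteness⟩
  refine ENNReal.eq_top_of_forall_nnreal_le fun C => ?_
  obtain ⟨n, hn⟩ := exists_le_two_pow C
  have hlt : (2 : ℝ≥0∞) ^ ((n + E : ℕ) : ℤ) < 2 ^ j * t₁ (ω, ω').1 := by
    rw [hω, ENNReal.mul_top (by positivity), zpow_natCast]
    finiteness
  refine le_trans ?_ (le_iSup₂ (f := fun (k : ℤ) (_ : (2 : ℝ≥0∞) ^ k < 2 ^ j * t₁ (ω, ω').1) =>
    2 ^ k * t₂ ((ω, ω').2, (ω, ω').1, k)) _ hlt)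
  calc (C : ℝ≥0∞) ≤ 2 ^ n * 1 := by simpa using hn
    _ ≤ 2 ^ n * (2 ^ E * t₂ (ω', ω, ((n + E : ℕ) : ℤ))) := by gcongr; exact hE _
    _ = _ := by rw [zpow_natCast, pow_add, mul_assoc]

theorem mul_le_prodTest {t₁ : Cantor → ℝ≥0∞} {t₂ : Cantor × Cantor × ℤ → ℝ≥0∞} {D E : ℕ}
    (hD : ∀ ω, 1 ≤ 2 ^ D * t₁ ω) (hE : ∀ x, 1 ≤ 2 ^ E * t₂ x) {R : ℕ} {ω : Cantor} {k : ℤ}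
    (hk : Near R k (t₁ ω)) (ω' : Cantor) :
    t₁ ω * t₂ (ω', ω, k) ≤ 2 ^ (2 * R + 2) * prodTest t₁ t₂ (R + 1) (ω, ω') := by
  rcases eq_or_ne (t₁ ω) ⊤ with htop | htop
  · rw [prodTest_eq_top hE _ htop, ENNReal.mul_top (by positivity)]
    exact le_top
  obtain ⟨hk1, hk2⟩ := hk htop
  have h0 : t₁ ω ≠ 0 := fun h0 => by simpa [h0] using hD ω
  -- The extra factor 2 (`j = R + 1`) turns the rounding bound into the strict inequality required
  -- by `prodTest`; this uses that `t₁ ω` is neither 0 nor infinite.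
  have hlt : (2 : ℝ≥0∞) ^ k < 2 ^ (R + 1) * t₁ (ω, ω').1 := by
    refine hk2.trans_lt ?_
    rw [pow_succ, mul_right_comm, mul_two]
    exact ENNReal.lt_add_right (by finiteness) (mul_ne_zero (by positivity) h0)
  have h1 := le_iSup₂ (f := fun (k : ℤ) (_ : (2 : ℝ≥0∞) ^ k < 2 ^ (R + 1) * t₁ (ω, ω').1) =>
    2 ^ k * t₂ ((ω, ω').2, (ω, ω').1, k)) _ hlt
  have h2 : 2 ^ k * t₂ (ω', ω, k) ≤
      prodTest t₁ t₂ (R + 1) (ω, ω') * ((2 ^ (R + 1 + 1) : ℕ) : ℝ≥0∞) := by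
    rw [prodTest, ENNReal.div_mul_cancel (by positivity) (by finiteness)]
    exact h1
  calc t₁ ω * t₂ (ω', ω, k) ≤ 2 ^ R * 2 ^ k * t₂ (ω', ω, k) := by gcongr
    _ = 2 ^ R * (2 ^ k * t₂ (ω', ω, k)) := mul_assoc _ _ _
    _ ≤ 2 ^ R * (prodTest t₁ t₂ (R + 1) (ω, ω') * ((2 ^ (R + 1 + 1) : ℕ) : ℝ≥0∞)) := by gcongr
    _ = _ := by push_cast; ring

theorem IsMaximalTest.exists_mul_le {t₁ : Cantor → ℝ≥0∞} {t₂ : Cantor × Cantor × ℤ → ℝ≥0∞}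
    {t : Cantor × Cantor → ℝ≥0∞} (ht : IsMaximalTest cylPair (P₁.compProd κ) t)
    (ht₁ : IsMaximalTest cyl P₁ t₁) (ht₂ : IsMaximalCondTest κ t₂) (R : ℕ) :
    ∃ n : ℕ, ∀ ω ω' k, Near R k (t₁ ω) → t₁ ω * t₂ (ω', ω, k) ≤ 2 ^ n * t (ω, ω') := by
  obtain ⟨D, hD⟩ := ht₁.exists_one_le
  obtain ⟨E, hE⟩ := ht₂.exists_one_le
  obtain ⟨C, hC⟩ := ht.maximal _ (isTest_prodTest ht₁.isTest ht₂.isCondTest (R + 1))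
  obtain ⟨n, hn⟩ := exists_le_two_pow C
  refine ⟨2 * R + 2 + n, fun ω ω' k hk => (mul_le_prodTest hD hE hk ω').trans ?_⟩
  rw [pow_add _ (2 * R + 2), mul_assoc]
  gcongr
  exact (hC _).trans (by gcongr)

/-- No enumeration of tests for the pair is needed: the product test of maximal tests dominates all
of them, by the upper bound with `k` chosen near `t₁ ω`. -/
theorem exists_isMaximalTest_pair (hP₁ : IsComputableMeasure P₁) (hκ : IsUniformlyComputable κ) :
    ∃ t, IsMaximalTest cylPair (P₁.compProd κ) t := by
  obtain ⟨t₁, ht₁⟩ := exists_isMaximalTest hP₁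
  obtain ⟨t₂, ht₂⟩ := exists_isMaximalCondTest hκ
  obtain ⟨D, hD⟩ := ht₁.exists_one_le
  obtain ⟨E, hE⟩ := ht₂.exists_one_le
  refine ⟨prodTest t₁ t₂ 2, isTest_prodTest ht₁.isTest ht₂.isCondTest 2, fun s hs => ?_⟩
  obtain ⟨n, hn⟩ := hs.exists_le_mul hκ ht₁ ht₂ 1
  refine ⟨2 ^ (n + 4), ?_⟩
  rintro ⟨ω, ω'⟩
  have h0 : t₁ ω ≠ 0 := fun h0 => by simpa [h0] using hD ω
  obtain ⟨k, hk⟩ := exists_near h0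
  calc s (ω, ω') ≤ 2 ^ n * (t₁ ω * t₂ (ω', ω, k)) := hn ω ω' k hk
    _ ≤ 2 ^ n * (2 ^ 4 * prodTest t₁ t₂ 2 (ω, ω')) := by
        exact mul_le_mul' le_rfl (mul_le_prodTest hD hE hk ω')
    _ = _ := by push_cast; ring

end Pair

/-! ### Passage to binary logarithms -/

theorem log_two_pos : (0 : EReal) < ((Real.log 2 : ℝ) : EReal) :=
  EReal.coe_pos.2 (Real.log_pos one_lt_two)

theorem log2_strictMono : StrictMono log2 :=
  (EReal.strictMono_div_right_of_pos log_two_pos (EReal.coe_ne_top _)).comp ENNReal.log_strictMono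

theorem log2_mul (x y : ℝ≥0∞) : log2 (x * y) = log2 x + log2 y := by
  unfold log2
  rw [ENNReal.log_mul_add]
  exact EReal.right_distrib_of_nonneg_of_ne_top
    (EReal.inv_nonneg_of_nonneg log_two_pos.le) (EReal.inv_lt_top _).ne _ _

theorem log2_two_rpow (x : ℝ) : log2 (2 ^ x) = (x : EReal) := by
  have h : ENNReal.log 2 = ((Real.log 2 : ℝ) : EReal) := by
    have := ENNReal.log_ofReal_of_pos (x := 2) two_pos
    simpa using this
  rw [log2, ENNReal.log_rpow, h, ← EReal.coe_mul, ← EReal.coe_div,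
    mul_div_assoc, div_self (Real.log_pos one_lt_two).ne', mul_one]

theorem IsRounding.near {r : ℝ} {x : ℝ≥0∞} {k : ℤ} (h : IsRounding r (log2 x) k) {R : ℕ}
    (hR : r ≤ R) : Near R k x := by
  intro hx
  have htop : log2 ⊤ = ⊤ := by
    rw [log2, ENNReal.log_top]
    exact EReal.top_div_of_pos_ne_top log_two_pos (EReal.coe_ne_top _)
  have hlog : log2 x ≠ ⊤ := fun h => hx (log2_strictMono.injective (h.trans htop.symm))
  obtain ⟨h1, h2⟩ := h hlog
  have hR2 : log2 (2 ^ R) = ((R : ℝ) : EReal) := by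
    rw [← ENNReal.rpow_natCast, log2_two_rpow]
  have hk : log2 (2 ^ k) = ((k : ℝ) : EReal) := by
    rw [← ENNReal.rpow_intCast, log2_two_rpow]
  constructor
  · rw [← log2_strictMono.le_iff_le, log2_mul, hR2, hk, ← EReal.coe_add]
    exact h1.trans (EReal.coe_le_coe_iff.2 (by linarith))
  · rw [← log2_strictMono.le_iff_le, log2_mul, hR2, hk]
    calc ((k : ℝ) : EReal) ≤ ((R + (k - r) : ℝ) : EReal) := EReal.coe_le_coe_iff.2 (by linarith)
      _ = (R : ℝ) + ((k - r : ℝ) : EReal) := EReal.coe_add _ _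
      _ ≤ _ := by gcongr

theorem log2_le_add_of_le {x y : ℝ≥0∞} {n : ℕ} (h : x ≤ 2 ^ n * y) {c : ℝ} (hc : n ≤ c) :
    log2 x ≤ log2 y + c := by
  calc log2 x ≤ log2 (2 ^ n * y) := log2_strictMono.monotone h
    _ = log2 y + ((n : ℝ) : EReal) := by
      rw [log2_mul, ← ENNReal.rpow_natCast, log2_two_rpow, add_comm]
    _ ≤ log2 y + c := by
      gcongr

end VovkVyugin

theorem mainTheorem6 (P₁ : Measure Cantor) [IsProbabilityMeasure P₁]
    (hP₁ : IsComputableMeasure P₁)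
    (κ : Kernel Cantor Cantor) [IsMarkovKernel κ] (hκ : IsUniformlyComputable κ) :
    (∃ t₁, IsMaximalTest cyl P₁ t₁) ∧
    (∃ t, IsMaximalTest cylPair (P₁.compProd κ) t) ∧
    (∃ t₂, IsMaximalCondTest κ t₂) ∧
    ∀ (t₁ : Cantor → ℝ≥0∞) (t : Cantor × Cantor → ℝ≥0∞) (t₂ : Cantor × Cantor × ℤ → ℝ≥0∞),
      IsMaximalTest cyl P₁ t₁ →
      IsMaximalTest cylPair (P₁.compProd κ) t →
      IsMaximalCondTest κ t₂ →
      ∀ r : ℝ, ∃ c : ℝ, ∀ (ω ω' : Cantor) (k : ℤ), IsRounding r (deficiency t₁ ω) k →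
        deficiency t (ω, ω') ≤ deficiency t₁ ω + deficiency t₂ (ω', ω, k) + (c : EReal) ∧
        deficiency t₁ ω + deficiency t₂ (ω', ω, k) ≤ deficiency t (ω, ω') + (c : EReal) := by
  refine ⟨exists_isMaximalTest hP₁, exists_isMaximalTest_pair hP₁ hκ, exists_isMaximalCondTest hκ,
    fun t₁ t t₂ ht₁ ht ht₂ r => ?_⟩
  obtain ⟨R, hR⟩ := exists_nat_ge r
  obtain ⟨m, hm⟩ := ht.isTest.exists_le_mul hκ ht₁ ht₂ R
  obtain ⟨n, hn⟩ := ht.exists_mul_le ht₁ ht₂ R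
  refine ⟨max m n, fun ω ω' k hk => ?_⟩
  -- If `t₁ ω` is infinite, this is vacuous, and the two inequalities hold for any integer `k`.
  have hnear : Near R k (t₁ ω) := IsRounding.near hk hR
  simp only [deficiency, ← log2_mul]
  exact ⟨log2_le_add_of_le (hm ω ω' k hnear) (le_max_left _ _),
    log2_le_add_of_le (hn ω ω' k hnear) (le_max_right _ _)⟩
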